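/- For a finite simple graph $G$ and an integer $\ell\ge 0$, let $\mathcal{C}_\ell(G)$ be the graph whose vertices are the proper colourings of $G$ with colours from a fixed set of $\ell$ colours, two colourings being adjacent precisely when they differ in the colour of exactly one vertex of $G$. Let $\chi(G)$ denote the chromatic number of $G$. Call $G$ $H$-free if no induced subgraph of $G$ is isomorphic to $H$. Let $P_3+P_1$ be the disjoint union of a path on three vertices and a single vertex, let $2K_2$ be the disjoint union of two edges, and let $C_4$ be the cycle on four vertices. Let $G$ be a graph on $n$ vertices and let $\ell\ge\chi(G)+1$. (1) If $G$ is $(P_3+P_1)$-free, then $\mathcal{C}_\ell(G)$ is connected and $\operatorname{diam}\mathcal{C}_\ell(G)\le\lfloor 9n/2\rfloor$. (2) If $G$ is both $2K_2$-free and $C_4$-free, then $\mathcal{C}_\ell(G)$ is connected and $\operatorname{diam}\mathcal{C}_\ell(G)\le\lfloor 7n/2\rfloor$. -/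

import Mathlib

open scoped SimpleGraph

/-- The `k`-recolouring graph `C_k(G)`: its vertices are the proper `k`-colourings of `G`, and two
of them are adjacent exactly when they differ in the colour of a single vertex of `G`. -/
def recolouringGraph {V : Type*} (G : SimpleGraph V) (k : ℕ) :
    SimpleGraph (G.Coloring (Fin k)) where
  Adj α β := ∃! v, α v ≠ β v
  symm := ⟨fun _ _ ⟨v, hv, hu⟩ => ⟨v, hv.symm, fun w hw => hu w hw.symm⟩⟩
  loopless := ⟨fun _ ⟨_, hv, _⟩ => hv rfl⟩

/-- `G` is `H`-free: no induced subgraph of `G` is isomorphic to `H`. -/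
def IsInducedFree {W V : Type*} (H : SimpleGraph W) (G : SimpleGraph V) : Prop :=
  ¬ H.IsIndContained G

/-- `P₃ + P₁`: the disjoint union of a path on three vertices and a single vertex. -/
abbrev graphP3P1 : SimpleGraph (Fin 3 ⊕ Fin 1) :=
  SimpleGraph.pathGraph 3 ⊕g SimpleGraph.pathGraph 1

/-- `2K₂`: the disjoint union of two edges. -/
abbrev graph2K2 : SimpleGraph (Fin 2 ⊕ Fin 2) :=
  SimpleGraph.completeGraph (Fin 2) ⊕g SimpleGraph.completeGraph (Fin 2)

open scoped Classical

/-! ### Renaming the colours of a colouring when one colour is spare -/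

section Recolouring

variable {V ι : Type*} {G : SimpleGraph V} {ℓ : ℕ}

/-! Every colouring is compared with one fixed colouring `g` that uses fewer than `ℓ` colours. Call
a colouring aligned if it is `g` followed by an injective renaming of the colours. Between two
aligned colourings, a class whose target colour is free moves directly. When none is, the remaining
moves form cycles, and each cycle is broken by parking its lightest class, at most half of its
vertices, on a spare colour. Hence aligned colourings are at distance at most `3n/2`
(`exists_rename`). If every colouring is within `N` of an aligned one, the diameter is at most `2N +
3n/2` (`edist_le_of_aligned`), so the two bounds need `N = 3n/2` (rounded down) and `N = n`.

Without induced `2K₂` and `C₄`, the graph splits into a clique, an independent set and possibly an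
induced `C₅` (`exists_split_or_five_cycle`, `five_cycle_adj_all_or_none`). The classes of `g` are
built around the clique vertices, and alignment recolours the independent set once each, after at
most four recolourings on the `C₅`.

Without induced `P₃ + P₁`, take `g` optimal. The complement has no induced paw, so each of its
components is triangle-free or complete multipartite (`adj_or_adj_of_paw_free`). Thus `G` is a join
of pieces that either have no independent triple or are disjoint unions of cliques. Each class of
`g` gets a representative, and a vertex is misaligned if its colour differs from that of its
representative. As long as some vertex is misaligned, progress is possible (`canAlign`): if all
colours are in use, some piece uses more colours than under `g`, and there is room to act there. A
misaligned vertex costs at most 2 in a piece of the first kind and 3/2 in one of the second. In the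
first kind each class has at most two vertices, one being the aligned representative, so the total
is at most `3n/2` (`sum_alignmentWeight_le`). -/

theorem edist_le_add {α β γ : G.Coloring (Fin ℓ)} {m n : ℕ}
    (h₁ : (recolouringGraph G ℓ).edist α β ≤ m) (h₂ : (recolouringGraph G ℓ).edist β γ ≤ n) :
    (recolouringGraph G ℓ).edist α γ ≤ (m + n : ℕ) := by
  push_cast
  exact SimpleGraph.edist_triangle.trans (add_le_add h₁ h₂)

theorem connected_and_ediam_le {k : ℕ} (hne : Nonempty (G.Coloring (Fin ℓ)))
    (h : ∀ α β : G.Coloring (Fin ℓ), (recolouringGraph G ℓ).edist α β ≤ k) :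
    (recolouringGraph G ℓ).Connected ∧ (recolouringGraph G ℓ).ediam ≤ k := by
  refine ⟨⟨fun α β => SimpleGraph.reachable_of_edist_ne_top ?_⟩,
    SimpleGraph.ediam_le_of_edist_le h⟩
  exact ((h α β).trans_lt (ENat.natCast_lt_top k)).ne

variable [Fintype V]

/-- Two colourings that differ only on an independent set can be joined by recolouring each vertex
of this set once. -/
theorem edist_le_card_of_independent (α β : G.Coloring (Fin ℓ))
    (h : ∀ u v, G.Adj u v → α u = β u ∨ α v = β v) :
    (recolouringGraph G ℓ).edist α β ≤ (Finset.univ.filter fun v => α v ≠ β v).card := by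
  induction hn : (Finset.univ.filter fun v => α v ≠ β v).card generalizing α with
  | zero =>
    have : α = β := by
      ext1 v
      by_contra hv
      have : v ∈ (Finset.univ.filter fun v => α v ≠ β v) := by simpa using hv
      simp [Finset.card_eq_zero.1 hn] at this
    simp [this]
  | succ n ih =>
    obtain ⟨v, hv⟩ : (Finset.univ.filter fun v => α v ≠ β v).Nonempty := by
      rw [← Finset.card_pos]; omega
    have hv' : α v ≠ β v := by simpa using hv
    let γ : G.Coloring (Fin ℓ) := SimpleGraph.Coloring.mk (Function.update α v (β v)) (by
      intro a b hab
      have hαab := α.valid hab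
      have hβab := β.valid hab
      have hh := h a b hab
      by_cases ha : a = v
      · subst ha
        have : b ≠ a := hab.ne'
        simp only [Function.update_self, Function.update_of_ne this]
        rcases hh with hh | hh
        · exact absurd hh hv'
        · rwa [hh]
      · by_cases hb : b = v
        · subst hb
          simp only [Function.update_self, Function.update_of_ne ha]
          rcases hh with hh | hh
          · rwa [hh]
          · exact absurd hh hv'
        · simpa only [Function.update_of_ne ha, Function.update_of_ne hb])
    have hγ : ∀ w, γ w = Function.update α v (β v) w := fun w => rfl
    have hadj : (recolouringGraph G ℓ).Adj α γ := by
      refine ⟨v, ?_, ?_⟩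
      · simpa [hγ] using hv'
      · intro w hw
        by_contra hwv
        simp [hγ, Function.update_of_ne hwv] at hw
    have hset : (Finset.univ.filter fun w => γ w ≠ β w)
        = (Finset.univ.filter fun w => α w ≠ β w).erase v := by
      ext w
      by_cases hwv : w = v
      · subst hwv; simp [hγ]
      · simp [hγ, hwv]
    have hγn : (Finset.univ.filter fun w => γ w ≠ β w).card = n := by
      rw [hset, Finset.card_erase_of_mem hv, hn]; rfl
    have h1 := ih γ (by
      intro a b hab
      rcases h a b hab with hh | hh
      · left
        by_cases ha : a = v
        · subst ha; exact absurd hh hv'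
        · simp [hγ, ha, hh]
      · right
        by_cases hb : b = v
        · subst hb; exact absurd hh hv'
        · simp [hγ, hb, hh]) hγn
    calc _ ≤ (recolouringGraph G ℓ).edist α γ + (recolouringGraph G ℓ).edist γ β :=
          SimpleGraph.edist_triangle
      _ ≤ 1 + n := add_le_add (SimpleGraph.edist_eq_one_iff_adj.2 hadj).le h1
      _ = _ := by push_cast; ring

/-- If `α` is given on `D` by renaming the classes of `g` by `σ`, then one whole class can be moved
to an unused colour `c` of the palette `P`. -/
theorem exists_recolour_class (g : G.Coloring ι) {D : Finset V} {J : Finset ι}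
    {P : Finset (Fin ℓ)} (hgD : ∀ v ∈ D, g v ∈ J) {σ : ι → Fin ℓ} {α : G.Coloring (Fin ℓ)}
    (hσ : Set.InjOn σ J) (hσP : ∀ j ∈ J, σ j ∈ P) (hα : ∀ v ∈ D, α v = σ (g v))
    (hP : ∀ u ∈ D, ∀ v, v ∉ D → G.Adj u v → α v ∉ P) {i : ι} {c : Fin ℓ}
    (hc : c ∈ P) (hcσ : c ∉ J.image σ) :
    Set.InjOn (Function.update σ i c) J ∧ (∀ j ∈ J, Function.update σ i c j ∈ P) ∧
    ∃ γ : G.Coloring (Fin ℓ), (∀ v ∈ D, γ v = Function.update σ i c (g v)) ∧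
      (∀ v, v ∉ D → γ v = α v) ∧
      (recolouringGraph G ℓ).edist α γ ≤ (D.filter fun v => g v = i).card := by
  have hcσ' : ∀ j ∈ J, σ j ≠ c := fun j hj h => hcσ (Finset.mem_image.2 ⟨j, hj, h⟩)
  have hinj : Set.InjOn (Function.update σ i c) J := by
    intro a ha b hb hab
    by_cases hai : a = i <;> by_cases hbi : b = i
    · rw [hai, hbi]
    · subst hai; simp [hbi] at hab; exact absurd hab.symm (hcσ' b hb)
    · subst hbi; simp [hai] at hab; exact absurd hab (hcσ' a ha)
    · simp [hai, hbi] at hab; exact hσ ha hb hab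
  have hmap : ∀ j ∈ J, Function.update σ i c j ∈ P := by
    intro j hj
    by_cases hji : j = i
    · subst hji; simpa using hc
    · simpa [hji] using hσP j hj
  refine ⟨hinj, hmap, ?_⟩
  let γ : G.Coloring (Fin ℓ) := SimpleGraph.Coloring.mk
    (fun v => if v ∈ D then Function.update σ i c (g v) else α v) (by
      intro a b hab
      by_cases ha : a ∈ D <;> by_cases hb : b ∈ D <;> simp only [ha, hb, if_true, if_false]
      · exact fun h => g.valid hab (hinj (hgD a ha) (hgD b hb) h)
      · exact fun h => hP a ha b hb hab (h ▸ hmap _ (hgD a ha))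
      · exact fun h => hP b hb a ha hab.symm (h ▸ hmap _ (hgD b hb))
      · exact α.valid hab)
  have hγ : ∀ v, γ v = if v ∈ D then Function.update σ i c (g v) else α v := fun _ => rfl
  have hdiff : ∀ v, α v ≠ γ v → v ∈ D ∧ g v = i := by
    intro v hv
    by_cases hD : v ∈ D
    · refine ⟨hD, ?_⟩
      by_contra hgi
      simp [hγ, hD, hgi, hα v hD] at hv
    · simp [hγ, hD] at hv
  refine ⟨γ, fun v hv => by simp [hγ, hv], fun v hv => by simp [hγ, hv], ?_⟩
  refine (edist_le_card_of_independent α γ ?_).trans ?_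
  · intro u v huv
    by_contra! h
    exact g.valid huv ((hdiff u h.1).2.trans (hdiff v h.2).2.symm)
  · refine Nat.cast_le.2 (Finset.card_le_card fun v hv => ?_)
    simpa using hdiff v (by simpa using hv)

/-- The set `Z` is the remaining credit for detours: it contains every set of unfinished classes
that `σ` and `τ` map onto the same colours, that is, every union of cycles still to be broken. Each
class pays its full weight for its final move, and each broken cycle pays half its weight for the
detour and then leaves `Z`. Both kinds of move decrease the number of unfinished classes plus the
size of `Z`. -/
theorem exists_rename_aux (g : G.Coloring ι) {D : Finset V} {J : Finset ι}
    {P : Finset (Fin ℓ)} (hgD : ∀ v ∈ D, g v ∈ J) (hJP : J.card < P.card) {τ : ι → Fin ℓ}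
    (hτ : Set.InjOn τ J) (hτP : ∀ j ∈ J, τ j ∈ P) (β : G.Coloring (Fin ℓ))
    (hβ : ∀ v ∈ D, β v = τ (g v)) (N : ℕ) :
    ∀ (Z : Finset ι) (σ : ι → Fin ℓ) (α : G.Coloring (Fin ℓ)),
      (J.filter fun j => σ j ≠ τ j).card + Z.card ≤ N →
      Set.InjOn σ J → (∀ j ∈ J, σ j ∈ P) → (∀ v ∈ D, α v = σ (g v)) →
      (∀ v, v ∉ D → β v = α v) →
      (∀ u ∈ D, ∀ v, v ∉ D → G.Adj u v → α v ∉ P) →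
      (∀ Y ⊆ J.filter fun j => σ j ≠ τ j, Y.image τ = Y.image σ → Y ⊆ Z) →
      ∃ m : ℕ, (recolouringGraph G ℓ).edist α β ≤ m ∧
        2 * m ≤ 2 * ∑ j ∈ J.filter (fun j => σ j ≠ τ j), (D.filter fun v => g v = j).card
          + ∑ j ∈ Z, (D.filter fun v => g v = j).card := by
  induction N with
  | zero =>
    intro Z σ α hN hσ hσP hα hβα hP hZ
    have hU : (J.filter fun j => σ j ≠ τ j) = ∅ := by
      rw [← Finset.card_eq_zero]; omega
    have : α = β := by
      ext1 v
      by_cases hv : v ∈ D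
      · rw [hα v hv, hβ v hv]
        by_contra hne
        have : g v ∈ J.filter fun j => σ j ≠ τ j := by simpa [hgD v hv] using hne
        simp [hU] at this
      · exact (hβα v hv).symm
    exact ⟨0, by simp [this], by omega⟩
  | succ N ih =>
    intro Z σ α hN hσ hσP hα hβα hP hZ
    set U := J.filter fun j => σ j ≠ τ j with hU
    have hUJ : U ⊆ J := Finset.filter_subset _ _
    set w : ι → ℕ := fun j => (D.filter fun v => g v = j).card with hw
    by_cases hex : ∃ i ∈ U, τ i ∉ J.image σ
    · obtain ⟨i, hiU, hi⟩ := hex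
      obtain ⟨h1, h2, γ, hγD, hγn, hγe⟩ := exists_recolour_class g hgD hσ hσP hα hP
        (i := i) (hτP i (hUJ hiU)) hi
      have hU' : (J.filter fun j => Function.update σ i (τ i) j ≠ τ j) = U.erase i := by
        ext j
        by_cases hji : j = i
        · subst hji; simp
        · simp [hji, hU]
      obtain ⟨m, hm, hm2⟩ := ih Z (Function.update σ i (τ i)) γ (by
          rw [hU', Finset.card_erase_of_mem hiU]
          have := Finset.card_pos.2 ⟨i, hiU⟩
          omega) h1 h2 hγD (fun v hv => (hβα v hv).trans (hγn v hv).symm)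
        (fun u hu v hv huv => by rw [hγn v hv]; exact hP u hu v hv huv) (by
          intro Y hY hYe
          rw [hU'] at hY
          refine hZ Y (hY.trans (Finset.erase_subset _ _)) (hYe.trans ?_)
          refine Finset.image_congr fun j hj => ?_
          have : j ≠ i := Finset.ne_of_mem_erase (hY hj)
          simp [this])
      refine ⟨w i + m, edist_le_add hγe hm, ?_⟩
      rw [hU'] at hm2
      have := Finset.add_sum_erase U w hiU
      simp only [hw] at this hm2 ⊢
      omega
    · push Not at hex
      rcases U.eq_empty_or_nonempty with hUe | hUne
      · have : α = β := by
          ext1 v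
          by_cases hv : v ∈ D
          · rw [hα v hv, hβ v hv]
            by_contra hne
            have : g v ∈ U := by simpa [hU, hgD v hv] using hne
            simp [hUe] at this
          · exact (hβα v hv).symm
        exact ⟨0, by simp [this], by omega⟩
      -- All targets are occupied, necessarily by classes that are themselves unfinished, so the
      -- unfinished classes form a union of cycles.
      · have hUcl : U.image τ = U.image σ := by
          refine Finset.eq_of_subset_of_card_le ?_ ?_
          · intro x hx
            obtain ⟨i, hi, rfl⟩ := Finset.mem_image.1 hx
            obtain ⟨j, hj, hji⟩ := Finset.mem_image.1 (hex i hi)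
            refine Finset.mem_image.2 ⟨j, ?_, hji⟩
            refine Finset.mem_filter.2 ⟨hj, fun hjj => ?_⟩
            have hij : j = i := hτ hj (hUJ hi) (hjj.symm.trans hji)
            subst hij
            exact (Finset.mem_filter.1 hi).2 hji
          · rw [Finset.card_image_of_injOn (hσ.mono (by exact_mod_cast hUJ)),
              Finset.card_image_of_injOn (hτ.mono (by exact_mod_cast hUJ))]
        have hUZ : U ⊆ Z := hZ U subset_rfl hUcl
        -- A minimal nonempty closed set is a single cycle. It has at least two classes, so its
        -- lightest class weighs at most half of it.
        obtain ⟨Z₀, hZ₀, hmin⟩ := Finset.exists_min_image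
          (U.powerset.filter fun Y => Y.Nonempty ∧ Y.image τ = Y.image σ) Finset.card
          ⟨U, by simp [hUne, hUcl]⟩
        simp only [Finset.mem_filter, Finset.mem_powerset] at hZ₀ hmin
        obtain ⟨hZ₀U, hZ₀ne, hZ₀cl⟩ := hZ₀
        obtain ⟨i, hi, himin⟩ := Finset.exists_min_image Z₀ w hZ₀ne
        obtain ⟨j, hj, hji⟩ : ∃ j ∈ Z₀, τ j = σ i := by
          have : σ i ∈ Z₀.image τ := hZ₀cl ▸ Finset.mem_image_of_mem σ hi
          simpa using this
        have hne : j ≠ i := by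
          rintro rfl
          exact (Finset.mem_filter.1 (hZ₀U hj)).2 hji.symm
        obtain ⟨c, hcP, hcσ⟩ : ∃ c ∈ P, c ∉ J.image σ := by
          refine Finset.exists_mem_notMem_of_card_lt_card ?_
          exact Finset.card_image_le.trans_lt hJP
        obtain ⟨h1, h2, γ, hγD, hγn, hγe⟩ := exists_recolour_class g hgD hσ hσP hα hP
          (i := i) hcP hcσ
        have hU' : (J.filter fun j => Function.update σ i c j ≠ τ j) = U := by
          ext k
          by_cases hki : k = i
          · subst hki
            have hk := hZ₀U hi
            have : c ≠ τ k := fun h => hcσ (h ▸ hex k hk)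
            simp [this, hk, hUJ hk]
          · simp [hki, hU]
        have hZ₀Z := hZ₀U.trans hUZ
        obtain ⟨m, hm, hm2⟩ := ih (Z \ Z₀) (Function.update σ i c) γ (by
            rw [hU', Finset.card_sdiff_of_subset hZ₀Z]
            have := Finset.card_pos.2 hZ₀ne
            have := Finset.card_le_card hZ₀Z
            omega) h1 h2 hγD (fun v hv => (hβα v hv).trans (hγn v hv).symm)
          (fun u hu v hv huv => by rw [hγn v hv]; exact hP u hu v hv huv) (by
            intro Y hY hYe
            rw [hU'] at hY
            -- The parking colour `c` is nobody's target, so no closed set contains `i` any more. A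
            -- closed set meeting `Z₀` would then contradict minimality.
            have hiY : i ∉ Y := by
              intro hiY
              have : c ∈ Y.image τ := by
                rw [hYe]; exact Finset.mem_image.2 ⟨i, hiY, by simp⟩
              obtain ⟨k, hk, rfl⟩ := Finset.mem_image.1 this
              exact hcσ (hex k (hY hk))
            have hYcl : Y.image τ = Y.image σ := by
              refine hYe.trans (Finset.image_congr fun k hk => ?_)
              have : k ≠ i := fun h => hiY (h ▸ hk)
              simp [this]
            have hYZ := hZ Y hY hYcl
            refine Finset.subset_sdiff.2 ⟨hYZ, ?_⟩
            rw [Finset.disjoint_iff_inter_eq_empty]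
            by_contra hne
            have hsub : ((Y : Set ι) ∪ Z₀) ⊆ J := by
              intro k hk
              rcases hk with hk | hk
              · exact hUJ (hY hk)
              · exact hUJ (hZ₀U hk)
            have hcl : (Y ∩ Z₀).image τ = (Y ∩ Z₀).image σ := by
              rw [Finset.image_inter_of_injOn _ _ (hτ.mono hsub),
                Finset.image_inter_of_injOn _ _ (hσ.mono hsub), hYcl, hZ₀cl]
            have hle := hmin (Y ∩ Z₀) ⟨Finset.inter_subset_left.trans hY,
              Finset.nonempty_iff_ne_empty.2 hne, hcl⟩
            have := Finset.eq_of_subset_of_card_le Finset.inter_subset_right hle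
            have hiYZ : i ∈ Y ∩ Z₀ := by rw [this]; exact hi
            exact hiY (Finset.mem_inter.1 hiYZ).1)
        refine ⟨w i + m, edist_le_add hγe hm, ?_⟩
        rw [hU'] at hm2
        have hs := Finset.sum_sdiff (f := w) hZ₀Z
        have hpair : w i + w j ≤ ∑ k ∈ Z₀, w k := by
          rw [← Finset.sum_pair hne.symm]
          exact Finset.sum_le_sum_of_subset (by
            intro k hk; rcases Finset.mem_insert.1 hk with rfl | hk
            · exact hi
            · rw [Finset.mem_singleton.1 hk]; exact hj)
        have := himin j hj
        simp only [hw] at this hs hpair hm2 ⊢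
        omega

/-- Suppose `α` and `β` agree outside `D`, and on `D` are given by renaming the classes of `g` by
`σ` and `τ`, both injective into a palette `P` that has a spare colour and is not used on the
neighbours of `D`. Then one gets from `α` to `β` with an average of at most `3/2` recolourings
for each vertex on which they differ. -/
theorem exists_rename (g : G.Coloring ι) {D : Finset V} {J : Finset ι}
    {P : Finset (Fin ℓ)} (hgD : ∀ v ∈ D, g v ∈ J) (hJP : J.card < P.card) {σ τ : ι → Fin ℓ}
    (hσ : Set.InjOn σ J) (hσP : ∀ j ∈ J, σ j ∈ P)
    (hτ : Set.InjOn τ J) (hτP : ∀ j ∈ J, τ j ∈ P) (α β : G.Coloring (Fin ℓ))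
    (hα : ∀ v ∈ D, α v = σ (g v)) (hβ : ∀ v ∈ D, β v = τ (g v))
    (hβα : ∀ v, v ∉ D → β v = α v)
    (hP : ∀ u ∈ D, ∀ v, v ∉ D → G.Adj u v → α v ∉ P) :
    ∃ m : ℕ, (recolouringGraph G ℓ).edist α β ≤ m ∧
      2 * m ≤ 3 * (Finset.univ.filter fun v => α v ≠ β v).card := by
  obtain ⟨m, hm, hm2⟩ := exists_rename_aux g hgD hJP hτ hτP β hβ _
    (J.filter fun j => σ j ≠ τ j) σ α le_rfl hσ hσP hα hβα hP (fun _ h _ => h)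
  refine ⟨m, hm, hm2.trans ?_⟩
  have : ∑ j ∈ J.filter (fun j => σ j ≠ τ j), (D.filter fun v => g v = j).card
      = (Finset.univ.filter fun v => α v ≠ β v).card := by
    rw [Finset.card_eq_sum_card_fiberwise (f := g) (t := J.filter (fun j => σ j ≠ τ j))]
    · refine Finset.sum_congr rfl fun j hj => congrArg _ ?_
      ext v
      simp only [Finset.mem_filter, Finset.mem_univ, true_and]
      refine ⟨fun h => ⟨?_, h.2⟩, fun h => ⟨?_, h.2⟩⟩
      · rw [hα v h.1, hβ v h.1, h.2]; exact (Finset.mem_filter.1 hj).2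
      · by_contra hv; exact h.1 (hβα v hv).symm
    · intro v hv
      have hv' : α v ≠ β v := by simpa using hv
      have hvD : v ∈ D := by by_contra h; exact hv' (hβα v h).symm
      rw [hα v hvD, hβ v hvD] at hv'
      simpa [hgD v hvD] using hv'
  omega

/-- If every colouring is within distance `N` of one whose classes are unions of classes of a
fixed colouring `g`, then the recolouring graph has small diameter. -/
theorem edist_le_of_aligned [Fintype ι] (g : G.Coloring ι) (hι : Fintype.card ι < ℓ) {N : ℕ}
    (h : ∀ α : G.Coloring (Fin ℓ), ∃ (γ : G.Coloring (Fin ℓ)) (σ : ι → Fin ℓ),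
      Function.Injective σ ∧ (∀ v, γ v = σ (g v)) ∧ (recolouringGraph G ℓ).edist α γ ≤ N)
    (α β : G.Coloring (Fin ℓ)) :
    (recolouringGraph G ℓ).edist α β ≤ (2 * N + 3 * Fintype.card V / 2 : ℕ) := by
  obtain ⟨γ, σ, hσ, hγ, hαγ⟩ := h α
  obtain ⟨δ, τ, hτ, hδ, hβδ⟩ := h β
  obtain ⟨m, hm, hm2⟩ := exists_rename g (D := Finset.univ) (J := Finset.univ)
    (P := Finset.univ) (fun _ _ => Finset.mem_univ _) (by simpa using hι) hσ.injOn (by simp)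
    hτ.injOn (by simp) γ δ (fun v _ => hγ v) (fun v _ => hδ v) (by simp) (by simp)
  rw [SimpleGraph.edist_comm] at hβδ
  refine (edist_le_add hαγ (edist_le_add hm hβδ)).trans (Nat.cast_le.2 ?_)
  have := Finset.card_le_univ (Finset.univ.filter fun v => γ v ≠ δ v)
  omega

end Recolouring

/-! ### Forbidden induced subgraphs and induced five-cycles -/

section InducedSubgraphs

variable {V : Type*} {G : SimpleGraph V}

theorem IsInducedFree.false_of_two_edges (h : IsInducedFree graph2K2 G) {a b c d : V}
    (hab : G.Adj a b) (hcd : G.Adj c d) (hac : ¬ G.Adj a c) (had : ¬ G.Adj a d)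
    (hbc : ¬ G.Adj b c) (hbd : ¬ G.Adj b d) : False := by
  have h1 : a ≠ c := by rintro rfl; exact had hcd
  have h2 : a ≠ d := by rintro rfl; exact hac hcd.symm
  have h3 : b ≠ c := by rintro rfl; exact hbd hcd
  have h4 : b ≠ d := by rintro rfl; exact hbc hcd.symm
  refine h ⟨⟨⟨Sum.elim ![a, b] ![c, d], ?_⟩, ?_⟩⟩
  · rintro (x | x) (y | y) hxy <;> fin_cases x <;> fin_cases y <;>
      simp_all [hab.ne, hab.ne', hcd.ne, hcd.ne', h1.symm, h2.symm, h3.symm, h4.symm]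
  · intro x y
    change G.Adj (Sum.elim ![a, b] ![c, d] x) (Sum.elim ![a, b] ![c, d] y) ↔ _
    rcases x with x | x <;> rcases y with y | y <;> fin_cases x <;> fin_cases y <;>
      simp_all [G.adj_comm]

theorem IsInducedFree.false_of_four_cycle (h : IsInducedFree (SimpleGraph.cycleGraph 4) G)
    {a b c d : V} (hab : G.Adj a b) (hbc : G.Adj b c) (hcd : G.Adj c d) (hda : G.Adj d a)
    (hac : ¬ G.Adj a c) (hbd : ¬ G.Adj b d) (hac' : a ≠ c) (hbd' : b ≠ d) : False := by
  have e1 := hab.symm; have e2 := hbc.symm; have e3 := hcd.symm; have e4 := hda.symm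
  have e5 : ¬ G.Adj c a := fun h => hac h.symm
  have e6 : ¬ G.Adj d b := fun h => hbd h.symm
  refine h ⟨⟨⟨![a, b, c, d], ?_⟩, ?_⟩⟩
  · intro x y hxy
    fin_cases x <;> fin_cases y <;>
      simp_all [hab.ne, hab.ne', hcd.ne, hcd.ne', hbc.ne, hbc.ne', hda.ne, hda.ne', hac'.symm,
        hbd'.symm]
  · intro x y
    have : ∀ x y : Fin 4, (SimpleGraph.cycleGraph 4).Adj x y ↔ (x = y + 1 ∨ y = x + 1) := by
      decide
    rw [this]
    change G.Adj (![a, b, c, d] x) (![a, b, c, d] y) ↔ _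
    fin_cases x <;> fin_cases y <;> simp_all

theorem IsInducedFree.false_of_path_and_vertex (h : IsInducedFree graphP3P1 G)
    {a b c d : V} (hab : G.Adj a b) (hbc : G.Adj b c) (hac : ¬ G.Adj a c) (hac' : a ≠ c)
    (hda : ¬ G.Adj d a) (hdb : ¬ G.Adj d b) (hdc : ¬ G.Adj d c)
    (hda' : d ≠ a) (hdb' : d ≠ b) (hdc' : d ≠ c) : False := by
  have e1 := hab.symm; have e2 := hbc.symm
  have e3 : ¬ G.Adj a d := fun h => hda h.symm
  have e4 : ¬ G.Adj b d := fun h => hdb h.symm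
  have e5 : ¬ G.Adj c d := fun h => hdc h.symm
  have e6 : ¬ G.Adj c a := fun h => hac h.symm
  refine h ⟨⟨⟨Sum.elim ![a, b, c] ![d], ?_⟩, ?_⟩⟩
  · rintro (x | x) (y | y) hxy <;> fin_cases x <;> fin_cases y <;>
      simp_all [hab.ne, hab.ne', hbc.ne, hbc.ne', hac'.symm, hda'.symm, hdb'.symm, hdc'.symm]
  -- Addition in `Fin 3` wraps around, so the step from 2 to 0 has to be excluded.
  · have hp : ∀ x y : Fin 3, (SimpleGraph.pathGraph 3).Adj x y ↔ (x + 1 = y ∧ x ≠ 2 ∨ y + 1 = x ∧ y ≠ 2) := by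
      intro x y
      rw [SimpleGraph.pathGraph_adj]
      fin_cases x <;> fin_cases y <;> simp
    intro x y
    change G.Adj (Sum.elim ![a, b, c] ![d] x) (Sum.elim ![a, b, c] ![d] y) ↔ _
    rcases x with x | x <;> rcases y with y | y
    · simp only [SimpleGraph.sum_adj, hp]
      fin_cases x <;> fin_cases y <;> simp_all
    all_goals fin_cases x <;> fin_cases y <;> simp_all

/-- If `c i = c (i + 2)`, then `c i` would be adjacent to `c (i + 3)`, whose second successor is `c
i`. -/
theorem five_cycle_injective {c : Fin 5 → V}
    (hc : ∀ i, G.Adj (c i) (c (i + 1)) ∧ ¬ G.Adj (c i) (c (i + 2))) : Function.Injective c := by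
  intro i j hij
  have key : ∀ i : Fin 5, c i ≠ c (i + 1) ∧ c i ≠ c (i + 2) := by
    intro i
    refine ⟨(hc i).1.ne, fun h => ?_⟩
    have h1 := (hc (i + 2)).1
    rw [← h] at h1
    have h2 := (hc (i + 2 + 1)).2
    have e : ∀ i : Fin 5, i + 2 + 1 + 2 = i := by decide
    rw [e] at h2
    exact h2 h1.symm
  by_contra hne
  have : j = i + 1 ∨ j = i + 2 ∨ i = j + 1 ∨ i = j + 2 := by
    clear hij; revert i j; decide
  rcases this with rfl | rfl | rfl | rfl
  · exact (key _).1 hij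
  · exact (key _).2 hij
  · exact (key _).1 hij.symm
  · exact (key _).2 hij.symm

/-- A neighbour of `c i` must see an end of the opposite edge, by `2K₂`-freeness, and a common
neighbour of `c i` and `c (i + 2)` must see `c (i + 1)`, by `C₄`-freeness. Only the empty and the
full pattern satisfy both rules. -/
theorem five_cycle_adj_all_or_none (h2 : IsInducedFree graph2K2 G)
    (h4 : IsInducedFree (SimpleGraph.cycleGraph 4) G) {c : Fin 5 → V}
    (hc : ∀ i, G.Adj (c i) (c (i + 1)) ∧ ¬ G.Adj (c i) (c (i + 2))) {v : V}
    (hv : ∀ i, v ≠ c i) : (∀ i, G.Adj v (c i)) ∨ ∀ i, ¬ G.Adj v (c i) := by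
  have hinj := five_cycle_injective hc
  have h1 : ∀ i, G.Adj v (c i) → G.Adj v (c (i + 2)) ∨ G.Adj v (c (i + 3)) := by
    intro i hi
    by_contra! h
    have e : ∀ i : Fin 5, i + 2 + 1 = i + 3 := by decide
    have e' : ∀ i : Fin 5, i + 3 + 2 = i := by decide
    refine h2.false_of_two_edges hi (e i ▸ (hc (i + 2)).1) h.1 h.2 (hc i).2 fun h' => ?_
    exact (hc (i + 3)).2 (by rw [e']; exact h'.symm)
  have h3 : ∀ i, G.Adj v (c i) → G.Adj v (c (i + 2)) → G.Adj v (c (i + 1)) := by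
    intro i hi hi2
    by_contra h
    have e : ∀ i : Fin 5, i + 1 + 1 = i + 2 := by decide
    have e' : ∀ i : Fin 5, i ≠ i + 2 := by decide
    exact h4.false_of_four_cycle hi (hc i).1 (e i ▸ (hc (i + 1)).1) hi2.symm h (hc i).2
      (hv _) (hinj.ne (e' i))
  have key : ∀ b : Fin 5 → Bool, (∀ i, b i → b (i + 2) ∨ b (i + 3)) →
      (∀ i, b i → b (i + 2) → b (i + 1)) → (∀ i, b i) ∨ ∀ i, ¬ b i := by decide
  simpa using key (fun i => decide (G.Adj v (c i))) (by simpa using h1) (by simpa using h3)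

/-- A clique completely joined to a five-cycle needs three colours on top of those of the
clique. -/
theorem card_add_three_le_of_colorable {K : Finset V} (hK : G.IsClique K) {c : Fin 5 → V}
    (hc : ∀ i, G.Adj (c i) (c (i + 1))) (hKc : ∀ v ∈ K, ∀ i, G.Adj v (c i)) {m : ℕ}
    (hm : G.Colorable m) : K.card + 3 ≤ m := by
  obtain ⟨f⟩ := hm
  have hf : ∀ i, f (c i) ≠ f (c (i + 1)) := fun i => f.valid (hc i)
  -- Otherwise two colours would alternate around an odd cycle.
  obtain ⟨i, hi0, hi1⟩ : ∃ i, f (c i) ≠ f (c 0) ∧ f (c i) ≠ f (c 1) := by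
    by_contra! h
    have a0 := hf 0; have a1 := hf 1; have a2 := hf 2; have a3 := hf 3; have a4 := hf 4
    have b2 := h 2; have b3 := h 3; have b4 := h 4
    simp only [Fin.isValue, Fin.reduceAdd] at a0 a1 a2 a3 a4
    grind
  have h01 : f (c 0) ≠ f (c 1) := hf 0
  have hdisj : Disjoint (K.image f) {f (c 0), f (c 1), f (c i)} := by
    rw [Finset.disjoint_left]
    intro x hx
    obtain ⟨v, hv, rfl⟩ := Finset.mem_image.1 hx
    have := fun j => f.valid (hKc v hv j)
    simp [this]
  have hcard := Finset.card_le_univ (K.image f ∪ {f (c 0), f (c 1), f (c i)})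
  have hKi : (K.image f).card = K.card := by
    refine Finset.card_image_of_injOn fun u hu v hv huv => ?_
    by_contra hne
    exact f.valid (hK hu hv hne) huv
  rw [Finset.card_union_of_disjoint hdisj, hKi, Fintype.card_fin] at hcard
  have : ({f (c 0), f (c 1), f (c i)} : Finset (Fin m)).card = 3 :=
    Finset.card_eq_three.2 ⟨_, _, _, h01, hi0.symm, hi1.symm, rfl⟩
  omega

end InducedSubgraphs

/-! ### Graphs without induced `2K₂` and `C₄` -/

section PseudoSplit

variable {V : Type*} [Fintype V] {G : SimpleGraph V} {ℓ : ℕ}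

/-- A graph without induced `2K₂` and `C₄` is a split graph, or contains an induced `C₅`. -/
theorem exists_split_or_five_cycle (h2 : IsInducedFree graph2K2 G)
    (h4 : IsInducedFree (SimpleGraph.cycleGraph 4) G) :
    (∃ K : Finset V, G.IsClique K ∧ (∀ x, x ∉ K → ∀ y, y ∉ K → ¬ G.Adj x y) ∧
      ∀ x, x ∉ K → ∃ a ∈ K, ¬ G.Adj x a) ∨
    ∃ c : Fin 5 → V, ∀ i, G.Adj (c i) (c (i + 1)) ∧ ¬ G.Adj (c i) (c (i + 2)) := by
  -- Every degree is less than `Fintype.card V`, so with this weight adding a vertex or exchanging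
  -- one for two is always a gain, while exchanging one for one compares degrees.
  obtain ⟨K, hK, hmax⟩ := Finset.exists_max_image
    (Finset.univ.filter fun K : Finset V => G.IsClique K)
    (fun K => ∑ v ∈ K, (Fintype.card V + G.degree v)) ⟨∅, by simp⟩
  simp only [Finset.mem_filter, Finset.mem_univ, true_and] at hK hmax
  have hnon : ∀ x, x ∉ K → ∃ a ∈ K, ¬ G.Adj x a := by
    intro x hx
    by_contra! hall
    have := hmax (insert x K) (by
      rw [Finset.coe_insert]
      exact hK.insert fun b hb _ => hall b hb)
    rw [Finset.sum_insert hx] at this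
    have : 0 < Fintype.card V := Fintype.card_pos_iff.2 ⟨x⟩
    omega
  by_cases hind : ∀ x, x ∉ K → ∀ y, y ∉ K → ¬ G.Adj x y
  · exact Or.inl ⟨K, hK, hind, hnon⟩
  right
  -- the non-neighbourhoods in `K` of two adjacent vertices outside `K` are nested
  obtain ⟨x, hx, y, hy, hxy, hsub⟩ : ∃ x, x ∉ K ∧ ∃ y, y ∉ K ∧ G.Adj x y ∧
      ∀ a ∈ K, ¬ G.Adj x a → ¬ G.Adj y a := by
    push Not at hind
    obtain ⟨x, hx, y, hy, hxy⟩ := hind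
    by_cases hs : ∀ a ∈ K, ¬ G.Adj x a → ¬ G.Adj y a
    · exact ⟨x, hx, y, hy, hxy, hs⟩
    refine ⟨y, hy, x, hx, hxy.symm, fun b hb hyb hxb => ?_⟩
    push Not at hs
    obtain ⟨a, ha, hxa, hya⟩ := hs
    have hab : a ≠ b := by rintro rfl; exact hxa hxb
    exact h4.false_of_four_cycle hxy hya (hK ha hb hab) hxb.symm hxa hyb
      (by rintro rfl; exact hx ha) (by rintro rfl; exact hy hb)
  obtain ⟨a, ha, hxa⟩ := hnon x hx
  have hya := hsub a ha hxa
  have huniq : ∀ b ∈ K, b ≠ a → G.Adj x b := by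
    intro b hb hba
    by_contra hxb
    exact h2.false_of_two_edges hxy (hK ha hb hba.symm) hxa hxb hya (hsub b hb hxb)
  have hxa' : x ≠ a := by rintro rfl; exact hx ha
  have hya' : y ≠ a := by rintro rfl; exact hy ha
  have hxK : x ∉ K.erase a := fun h => hx (Finset.mem_of_mem_erase h)
  have hcl : G.IsClique (insert x (K.erase a) : Finset V) := by
    rw [Finset.coe_insert]
    refine SimpleGraph.IsClique.insert (hK.subset (by simp)) fun b hb _ => ?_
    have hb' := Finset.mem_erase.1 (Finset.mem_coe.1 hb)
    exact huniq b hb'.2 hb'.1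
  have hsum := Finset.add_sum_erase K (fun v => Fintype.card V + G.degree v) ha
  -- Otherwise `a` could be exchanged for both `x` and `y`.
  obtain ⟨b, hb, hba, hyb⟩ : ∃ b ∈ K, b ≠ a ∧ ¬ G.Adj y b := by
    by_contra! hall
    have hyK : y ∉ insert x (K.erase a) := by
      rw [Finset.mem_insert, not_or]
      exact ⟨hxy.ne', fun h => hy (Finset.mem_of_mem_erase h)⟩
    have := hmax (insert y (insert x (K.erase a))) (by
      rw [Finset.coe_insert]
      refine hcl.insert fun b hb _ => ?_
      rcases Finset.mem_insert.1 (Finset.mem_coe.1 hb) with rfl | hb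
      · exact hxy.symm
      · exact hall b (Finset.mem_of_mem_erase hb) (Finset.ne_of_mem_erase hb))
    rw [Finset.sum_insert hyK, Finset.sum_insert hxK] at this
    have := G.degree_lt_card_verts a
    omega
  -- Otherwise exchanging `a` for `x` would raise the degree sum, since `y` is adjacent to `x` and
  -- not to `a`.
  obtain ⟨z, haz, hxz⟩ : ∃ z, G.Adj a z ∧ ¬ G.Adj x z := by
    by_contra! hall
    have hle := hmax _ hcl
    rw [Finset.sum_insert hxK] at hle
    have : G.degree a < G.degree x := by
      rw [← SimpleGraph.card_neighborFinset_eq_degree, ← SimpleGraph.card_neighborFinset_eq_degree]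
      refine Finset.card_lt_card ((Finset.ssubset_iff_of_subset ?_).2 ⟨y, ?_, ?_⟩)
      · intro z hz
        simpa using hall z (by simpa using hz)
      · simpa using hxy
      · simpa using fun h => hya h.symm
    omega
  have hxb := huniq b hb hba
  have hzK : z ∉ K := fun hz => hxz (huniq z hz haz.ne')
  have hab := hK ha hb hba.symm
  have hyz : G.Adj y z := by
    by_contra hyz
    exact h2.false_of_two_edges hxy haz hxa hxz hya hyz
  have hbz : ¬ G.Adj b z := fun hbz =>
    h4.false_of_four_cycle hxb hbz hyz.symm hxy.symm hxz (fun h => hyb h.symm)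
      (by rintro rfl; exact hxa haz.symm) (by rintro rfl; exact hy hb)
  refine ⟨![a, b, x, y, z], fun i => ?_⟩
  fin_cases i
  · exact ⟨hab, fun h => hxa h.symm⟩
  · exact ⟨hxb.symm, fun h => hyb h.symm⟩
  · exact ⟨hxy, hxz⟩
  · exact ⟨hyz, hya⟩
  · exact ⟨haz.symm, fun h => hbz h.symm⟩

theorem exists_recolour_vertex (α : G.Coloring (Fin ℓ)) {v : V} {x : Fin ℓ}
    (h : ∀ w, G.Adj v w → α w ≠ x) :
    ∃ γ : G.Coloring (Fin ℓ), (recolouringGraph G ℓ).edist α γ ≤ (1 : ℕ) ∧ γ v = x ∧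
      ∀ w, w ≠ v → γ w = α w := by
  let γ : G.Coloring (Fin ℓ) := SimpleGraph.Coloring.mk (Function.update α v x) (by
    intro a b hab
    by_cases ha : a = v
    · subst ha
      rw [Function.update_self, Function.update_of_ne hab.ne']
      exact (h b hab).symm
    · by_cases hb : b = v
      · subst hb
        rw [Function.update_self, Function.update_of_ne ha]
        exact h a hab.symm
      · rw [Function.update_of_ne ha, Function.update_of_ne hb]
        exact α.valid hab)
  have hγ : ∀ w, γ w = Function.update α v x w := fun _ => rfl
  have hd : ∀ w, α w ≠ γ w → w = v := by
    intro w hw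
    by_contra hwv
    simp [hγ, hwv] at hw
  refine ⟨γ, (edist_le_card_of_independent α γ fun a b hab => ?_).trans (Nat.cast_le.2 ?_),
    by simp [hγ], fun w hw => by simp [hγ, hw]⟩
  · by_contra! hh
    exact hab.ne ((hd a hh.1).trans (hd b hh.2).symm)
  · rw [← Finset.card_singleton v]
    exact Finset.card_le_card fun w hw => by simpa using hd w (by simpa using hw)

/-- On a five-cycle whose other neighbours are the vertices of `K`, two recolourings suffice to
give a vertex and its second successor the same colour. -/
theorem exists_recolour_five_cycle {K : Finset V} {c : Fin 5 → V}
    (hc : ∀ i, G.Adj (c i) (c (i + 1)) ∧ ¬ G.Adj (c i) (c (i + 2)))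
    (hKc : ∀ v ∈ K, ∀ i, G.Adj v (c i))
    (hnb : ∀ i w, G.Adj (c i) w → w ∈ K ∨ ∃ j, w = c j) (hℓ : K.card + 3 < ℓ)
    (α : G.Coloring (Fin ℓ)) (i : Fin 5) :
    ∃ γ : G.Coloring (Fin ℓ), (recolouringGraph G ℓ).edist α γ ≤ (2 : ℕ) ∧
      γ (c i) = γ (c (i + 2)) ∧ ∀ w, w ≠ c (i + 2) → w ≠ c (i + 3) → γ w = α w := by
  have hinj := five_cycle_injective hc
  have hcadj : ∀ i j, G.Adj (c i) (c j) → j = i + 1 ∨ j = i + 4 := by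
    intro i j hij
    have : j = i ∨ j = i + 1 ∨ j = i + 2 ∨ i = j + 2 ∨ j = i + 4 := by
      clear hij; revert i j; decide
    rcases this with rfl | h | rfl | rfl | h
    · exact absurd hij (G.loopless.irrefl _)
    · exact Or.inl h
    · exact absurd hij (hc i).2
    · exact absurd hij.symm (hc j).2
    · exact Or.inr h
  have e1 : i + 1 + 1 = i + 2 := by revert i; decide
  have e2 : i + 2 + 1 = i + 3 := by revert i; decide
  have e3 : i + 3 + 1 = i + 4 := by revert i; decide
  have e4 : i + 2 + 4 = i + 1 := by revert i; decide
  have e5 : i + 3 + 4 = i + 2 := by revert i; decide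
  have n02 : i ≠ i + 2 := by revert i; decide
  have n03 : i ≠ i + 3 := by revert i; decide
  have n13 : i + 1 ≠ i + 3 := by revert i; decide
  -- the second vertex may take any colour missing on its neighbours
  have hmove : ∀ β : G.Coloring (Fin ℓ), β (c (i + 3)) ≠ β (c i) →
      ∃ γ : G.Coloring (Fin ℓ), (recolouringGraph G ℓ).edist β γ ≤ (1 : ℕ) ∧
        γ (c i) = γ (c (i + 2)) ∧ ∀ w, w ≠ c (i + 2) → γ w = β w := by
    intro β hβ
    obtain ⟨γ, hγ, hγ2, hγn⟩ := exists_recolour_vertex β (v := c (i + 2)) (x := β (c i)) (by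
      intro w hw
      rcases hnb _ _ hw with hwK | ⟨j, rfl⟩
      · exact β.valid (hKc w hwK i)
      · rcases hcadj _ _ hw with rfl | rfl
        · rwa [e2]
        · rw [e4]; exact (β.valid (hc i).1).symm)
    exact ⟨γ, hγ, by rw [hγ2, hγn _ (hinj.ne n02)], hγn⟩
  by_cases h02 : α (c i) = α (c (i + 2))
  · exact ⟨α, by simp, h02, fun _ _ _ => rfl⟩
  by_cases h03 : α (c (i + 3)) = α (c i)
  -- Here `c (i + 3)` blocks the wanted colour at `c (i + 2)` and has to move away first; at most
  -- `K.card + 3` colours are excluded for it, including its present one.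
  · obtain ⟨x, hx⟩ : ∃ x, x ∉ K.image α ∪ {α (c (i + 2)), α (c (i + 4)), α (c i)} := by
      by_contra! hall
      have h1 := Finset.card_le_card (fun x _ => hall x : (Finset.univ : Finset (Fin ℓ)) ⊆ _)
      have h2 := h1.trans (Finset.card_union_le _ _)
      have h3 := Finset.card_image_le (s := K) (f := α)
      have h4 := Finset.card_le_three (a := α (c (i + 2))) (b := α (c (i + 4))) (c := α (c i))
      rw [Finset.card_univ, Fintype.card_fin] at h2
      omega
    simp only [Finset.mem_union, Finset.mem_image, Finset.mem_insert, Finset.mem_singleton,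
      not_or, not_exists, not_and] at hx
    obtain ⟨hxK, hx2, hx4, hx0⟩ := hx
    obtain ⟨β, hβ, hβ3, hβn⟩ := exists_recolour_vertex α (v := c (i + 3)) (x := x) (by
      intro w hw
      rcases hnb _ _ hw with hwK | ⟨j, rfl⟩
      · exact hxK w hwK
      · rcases hcadj _ _ hw with rfl | rfl
        · rw [e3]; exact fun h => hx4 h.symm
        · rw [e5]; exact fun h => hx2 h.symm)
    obtain ⟨γ, hγ, hγe, hγn⟩ := hmove β (by rwa [hβ3, hβn _ (hinj.ne n03)])
    exact ⟨γ, edist_le_add hβ hγ, hγe, fun w h2 h3 => (hγn w h2).trans (hβn w h3)⟩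
  · obtain ⟨γ, hγ, hγe, hγn⟩ := hmove α h03
    exact ⟨γ, hγ.trans (by norm_num), hγe, fun w h2 _ => hγn w h2⟩

/-- Each vertex outside `K` joins the class of a non-neighbour in `K`. The vertices of `K` have
distinct colours under any colouring, so alignment only copies these to the independent set, at a
cost of at most `n`. -/
theorem edist_le_of_split {K : Finset V} (hK : G.IsClique K)
    (hS : ∀ x, x ∉ K → ∀ y, y ∉ K → ¬ G.Adj x y) (hf : ∀ x, x ∉ K → ∃ a ∈ K, ¬ G.Adj x a)
    (hℓ : K.card < ℓ) (α β : G.Coloring (Fin ℓ)) :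
    (recolouringGraph G ℓ).edist α β ≤ (7 * Fintype.card V / 2 : ℕ) := by
  choose f hfK hfadj using hf
  let g₀ : V → K := fun v => if h : v ∈ K then ⟨v, h⟩ else ⟨f v h, hfK v h⟩
  have hg₀K : ∀ v (h : v ∈ K), g₀ v = ⟨v, h⟩ := fun v h => by simp [g₀, h]
  have hg₀S : ∀ v, v ∉ K → ¬ G.Adj v (g₀ v) := fun v h => by simpa [g₀, h] using hfadj v h
  let g : G.Coloring K := SimpleGraph.Coloring.mk g₀ (by
    intro u v huv h
    by_cases hu : u ∈ K
    · by_cases hv : v ∈ K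
      · rw [hg₀K u hu, hg₀K v hv] at h
        exact huv.ne (by simpa using h)
      · rw [hg₀K u hu] at h
        have := hg₀S v hv
        rw [← h] at this
        exact this huv.symm
    · by_cases hv : v ∈ K
      · rw [hg₀K v hv] at h
        have := hg₀S u hu
        rw [h] at this
        exact this huv
      · exact hS u hu v hv huv)
  refine (edist_le_of_aligned g (by simpa using hℓ) (N := Fintype.card V) (fun α => ?_) α β).trans
    (Nat.cast_le.2 (by omega))
  have hσ : Function.Injective fun a : K => α a := by
    intro a b hab
    by_contra hne
    exact α.valid (hK a.2 b.2 fun h => hne (Subtype.ext h)) hab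
  let γ : G.Coloring (Fin ℓ) := SimpleGraph.Coloring.mk (fun v => α (g v)) (by
    intro u v huv h
    exact g.valid huv (hσ h))
  refine ⟨γ, fun a => α a, hσ, fun _ => rfl, ?_⟩
  refine (edist_le_card_of_independent α γ fun u v huv => ?_).trans
    (Nat.cast_le.2 (Finset.card_le_univ _))
  have hsame : ∀ v ∈ K, α v = γ v := fun v hv => by
    change α v = α (g₀ v)
    rw [hg₀K v hv]
  by_contra! h
  exact hS u (fun hu => h.1 (hsame u hu)) v (fun hv => h.2 (hsame v hv)) huv

/-- The classes are the single vertices of `K`, two non-adjacent pairs of the five-cycle, and its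
last vertex together with `S`. Four recolourings unify the pairs and `S` is recoloured once; as the
cycle has five vertices, this is at most `n`. -/
theorem edist_le_of_five_cycle {K S : Finset V} {c : Fin 5 → V} (hK : G.IsClique K)
    (hc : ∀ i, G.Adj (c i) (c (i + 1)) ∧ ¬ G.Adj (c i) (c (i + 2)))
    (hKc : ∀ v ∈ K, ∀ i, G.Adj v (c i)) (hS : ∀ x ∈ S, ∀ y ∈ S, ¬ G.Adj x y)
    (hSc : ∀ v ∈ S, ∀ i, v ≠ c i ∧ ¬ G.Adj v (c i)) (hKS : Disjoint K S)
    (hV : ∀ v, v ∈ K ∨ (∃ i, v = c i) ∨ v ∈ S)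
    (hℓ : K.card + 3 < ℓ) (α β : G.Coloring (Fin ℓ)) :
    (recolouringGraph G ℓ).edist α β ≤ (7 * Fintype.card V / 2 : ℕ) := by
  have hinj := five_cycle_injective hc
  have hcK : ∀ i, c i ∉ K := fun i h => G.loopless.irrefl _ (hKc _ h i)
  have hcS : ∀ i, c i ∉ S := fun i h => (hSc _ h i).1 rfl
  let t : Fin 5 → Fin 3 := ![0, 1, 0, 1, 2]
  let g₀ : V → K ⊕ Fin 3 := fun v => if h : v ∈ K then Sum.inl ⟨v, h⟩ else
    if v = c 0 ∨ v = c 2 then Sum.inr 0 else if v = c 1 ∨ v = c 3 then Sum.inr 1 else Sum.inr 2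
  have hgK : ∀ v (h : v ∈ K), g₀ v = Sum.inl ⟨v, h⟩ := fun v h => by simp [g₀, h]
  have hgc : ∀ i, g₀ (c i) = Sum.inr (t i) := fun i => by
    simp only [g₀, hcK, dif_neg, not_false_eq_true, hinj.eq_iff]
    fin_cases i <;> simp [t]
  have hgS : ∀ v ∈ S, g₀ v = Sum.inr 2 := fun v h => by
    simp [g₀, Finset.disjoint_right.1 hKS h, (hSc v h _).1]
  have htadj : ∀ i j, G.Adj (c i) (c j) → t i ≠ t j := by
    intro i j hij h
    have : i = j ∨ j = i + 2 ∨ i = j + 2 := by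
      clear hij; revert i j; decide
    rcases this with rfl | rfl | rfl
    · exact G.loopless.irrefl _ hij
    · exact (hc i).2 hij
    · exact (hc j).2 hij.symm
  have hvalid : ∀ u v, G.Adj u v → g₀ u ≠ g₀ v := by
    intro u v huv
    rcases hV u with hu | ⟨i, rfl⟩ | hu <;> rcases hV v with hv | ⟨j, rfl⟩ | hv
    · rw [hgK u hu, hgK v hv]; simpa using huv.ne
    · rw [hgK u hu, hgc]; simp
    · rw [hgK u hu, hgS v hv]; simp
    · rw [hgc, hgK v hv]; simp
    · rw [hgc, hgc]; simpa using htadj i j huv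
    · exact absurd huv.symm (hSc v hv i).2
    · rw [hgS u hu, hgK v hv]; simp
    · exact absurd huv (hSc u hu j).2
    · exact absurd huv (hS u hu v hv)
  let g : G.Coloring (K ⊕ Fin 3) := SimpleGraph.Coloring.mk g₀ fun {u v} => hvalid u v
  refine (edist_le_of_aligned g (by simpa using hℓ) (N := Fintype.card V) (fun α => ?_) α β).trans
    (Nat.cast_le.2 (by omega))
  have hnb : ∀ i w, G.Adj (c i) w → w ∈ K ∨ ∃ j, w = c j := by
    intro i w hw
    rcases hV w with h | h | h
    · exact Or.inl h
    · exact Or.inr h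
    · exact absurd hw.symm (hSc w h i).2
  -- The first call changes only `c 2` and `c 3`, the second only `c 3` and `c 4`, so the second
  -- keeps the agreement of `c 0` and `c 2`.
  obtain ⟨α₁, hα₁, he₁, hn₁⟩ := exists_recolour_five_cycle hc hKc hnb hℓ α 0
  obtain ⟨α₂, hα₂, he₂, hn₂⟩ := exists_recolour_five_cycle hc hKc hnb hℓ α₁ 1
  simp only [Fin.isValue, zero_add, Fin.reduceAdd] at he₁ hn₁ he₂ hn₂
  have h02 : α₂ (c 0) = α₂ (c 2) := by
    rw [hn₂ _ (hinj.ne (by decide)) (hinj.ne (by decide)),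
      hn₂ _ (hinj.ne (by decide)) (hinj.ne (by decide)), he₁]
  let σ : K ⊕ Fin 3 → Fin ℓ := Sum.elim (fun a => α₂ a) ![α₂ (c 0), α₂ (c 1), α₂ (c 4)]
  have h01 := α₂.valid (hc 0).1
  have h34 := α₂.valid (hc 3).1
  have h40 := α₂.valid (hc 4).1
  simp only [Fin.isValue, zero_add, Fin.reduceAdd] at h01 h34 h40
  rw [← he₂] at h34
  have hσc : ∀ i, σ (Sum.inr (t i)) = α₂ (c i) := by
    intro i
    fin_cases i <;> simp [σ, t, h02, he₂]
  have hσ : Function.Injective σ := by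
    have hts : ∀ j : Fin 3, ∃ i, j = t i := by decide
    rintro (a | a) (b | b) hab
    · by_contra hne
      exact α₂.valid (hK a.2 b.2 fun h => hne (by rw [Subtype.ext h])) hab
    · obtain ⟨i, rfl⟩ := hts b
      rw [hσc] at hab
      exact absurd hab (α₂.valid (hKc a a.2 i))
    · obtain ⟨i, rfl⟩ := hts a
      rw [hσc] at hab
      exact absurd hab.symm (α₂.valid (hKc b b.2 i))
    · fin_cases a <;> fin_cases b <;> simp_all [σ]
  let γ : G.Coloring (Fin ℓ) := SimpleGraph.Coloring.mk (fun v => σ (g v)) (by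
    intro u v huv h
    exact g.valid huv (hσ h))
  have hsame : ∀ v, v ∉ S → α₂ v = γ v := by
    intro v hv
    change α₂ v = σ (g₀ v)
    rcases hV v with h | ⟨i, rfl⟩ | h
    · rw [hgK v h]; rfl
    · rw [hgc, hσc]
    · exact absurd h hv
  refine ⟨γ, σ, hσ, fun _ => rfl, ?_⟩
  have hlast : (recolouringGraph G ℓ).edist α₂ γ ≤ (S.card : ℕ) := by
    refine (edist_le_card_of_independent α₂ γ fun u v huv => ?_).trans
      (Nat.cast_le.2 (Finset.card_le_card fun v hv => ?_))
    · by_contra! h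
      refine hS u ?_ v ?_ huv
      · by_contra hu; exact h.1 (hsame u hu)
      · by_contra hu; exact h.2 (hsame v hu)
    · by_contra h
      exact (by simpa using hv : α₂ v ≠ γ v) (hsame v h)
  refine (edist_le_add hα₁ (edist_le_add hα₂ hlast)).trans (Nat.cast_le.2 ?_)
  have hdisj : Disjoint S (Finset.univ.image c) := by
    rw [Finset.disjoint_right]
    intro v hv
    obtain ⟨i, -, rfl⟩ := Finset.mem_image.1 hv
    exact hcS i
  have := Finset.card_le_univ (S ∪ Finset.univ.image c)
  rw [Finset.card_union_of_disjoint hdisj, Finset.card_image_of_injective _ hinj] at this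
  simp at this
  omega

theorem edist_le_of_two_edge_free_of_four_cycle_free (h2 : IsInducedFree graph2K2 G)
    (h4 : IsInducedFree (SimpleGraph.cycleGraph 4) G) {k : ℕ} (hk : G.Colorable k) (hkℓ : k < ℓ)
    (α β : G.Coloring (Fin ℓ)) :
    (recolouringGraph G ℓ).edist α β ≤ (7 * Fintype.card V / 2 : ℕ) := by
  rcases exists_split_or_five_cycle h2 h4 with ⟨K, hK, hS, hf⟩ | ⟨c, hc⟩
  · exact edist_le_of_split hK hS hf ((hK.card_le_of_colorable hk).trans_lt hkℓ) α β
  have hKc : ∀ v ∈ Finset.univ.filter (fun v => ∀ i, G.Adj v (c i)), ∀ i, G.Adj v (c i) := by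
    simp
  have hK : G.IsClique (Finset.univ.filter fun v => ∀ i, G.Adj v (c i) : Finset V) := by
    intro u hu v hv huv
    by_contra hadj
    have hu' := hKc u hu
    have hv' := hKc v hv
    exact h4.false_of_four_cycle (hu' 0) (hv' 0).symm (hv' 2) (hu' 2).symm hadj (hc 0).2 huv
      ((five_cycle_injective hc).ne (by decide))
  refine edist_le_of_five_cycle (S := Finset.univ.filter fun v => ∀ i, v ≠ c i ∧ ¬ G.Adj v (c i))
    hK hc hKc ?_ (by simp) ?_ ?_
    ((card_add_three_le_of_colorable hK (fun i => (hc i).1) hKc hk).trans_lt hkℓ) α β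
  · intro x hx y hy hxy
    simp only [Finset.mem_filter, Finset.mem_univ, true_and] at hx hy
    exact h2.false_of_two_edges hxy (hc 0).1 (hx _).2 (hx _).2 (hy _).2 (hy _).2
  · rw [Finset.disjoint_left]
    intro v hv hv'
    simp only [Finset.mem_filter, Finset.mem_univ, true_and] at hv hv'
    exact (hv' 0).2 (hv 0)
  · intro v
    by_cases hv : ∃ i, v = c i
    · exact Or.inr (Or.inl hv)
    push Not at hv
    rcases five_cycle_adj_all_or_none h2 h4 hc hv with h | h
    · exact Or.inl (by simpa using h)
    · exact Or.inr (Or.inr (by simpa using fun i => ⟨hv i, h i⟩))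

end PseudoSplit

/-! ### Paw-free graphs with a triangle -/

section PawFree

variable {V : Type*} {H : SimpleGraph V}

/-- In a connected component of a paw-free graph that has a triangle, every edge dominates the
component. -/
theorem adj_or_adj_of_paw_free
    (hpaw : ∀ p q s w, H.Adj p q → H.Adj q s → H.Adj p s → H.Adj w p → w ≠ q → w ≠ s →
      H.Adj w q ∨ H.Adj w s)
    {x₀ a₀ b₀ : V} (hxa : H.Adj x₀ a₀) (hab : H.Adj a₀ b₀) (hxb : H.Adj x₀ b₀) {y u v : V}
    (hy : H.Reachable x₀ y) (hu : H.Reachable x₀ u) (huv : H.Adj u v) :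
    H.Adj y u ∨ H.Adj y v := by
  -- Lying in a triangle passes from a vertex to its neighbours, hence along walks; `hedge` then
  -- puts every edge of the component in a triangle.
  have htri : ∀ {u w : V} (_ : H.Walk u w), (∃ a b, H.Adj u a ∧ H.Adj a b ∧ H.Adj u b) →
      ∃ a b, H.Adj w a ∧ H.Adj a b ∧ H.Adj w b := by
    intro u w p
    induction p with
    | nil => exact id
    | @cons t v w htv _ ih =>
      rintro ⟨a, b, hta, hab, htb⟩
      refine ih ?_
      by_cases hva : v = a
      · subst hva; exact ⟨t, b, htv.symm, htb, hab⟩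
      by_cases hvb : v = b
      · subst hvb; exact ⟨t, a, htv.symm, hta, hab.symm⟩
      rcases hpaw t a b v hta hab htb htv.symm hva hvb with h | h
      · exact ⟨t, a, htv.symm, hta, h⟩
      · exact ⟨t, b, htv.symm, htb, h⟩
  have hedge : ∀ {u v : V}, H.Reachable x₀ u → H.Adj u v → ∃ t, H.Adj u t ∧ H.Adj v t := by
    rintro u v ⟨p⟩ huv
    obtain ⟨a, b, hua, hab, hub⟩ := htri p ⟨a₀, b₀, hxa, hab, hxb⟩
    by_cases hva : v = a
    · subst hva; exact ⟨b, hub, hab⟩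
    by_cases hvb : v = b
    · subst hvb; exact ⟨a, hua, hab.symm⟩
    rcases hpaw u a b v hua hab hub huv.symm hva hvb with h | h
    · exact ⟨a, hua, h⟩
    · exact ⟨b, hub, h⟩
  -- The property that `y` sees an end of every edge at `w` spreads along walks. It holds trivially
  -- at `w = y`.
  have hdom : ∀ {w z : V} (_ : H.Walk w z), H.Reachable x₀ w →
      (∀ w', H.Adj w w' → H.Adj y w ∨ H.Adj y w') →
      ∀ w', H.Adj z w' → H.Adj y z ∨ H.Adj y w' := by
    intro w z p
    induction p with
    | nil => exact fun _ h => h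
    | @cons w z _ hwz _ ih =>
      intro hw hP
      have hz := hw.trans hwz.reachable
      refine ih hz fun z' hzz' => ?_
      by_contra! hn
      obtain ⟨hyz, hyz'⟩ := hn
      have hyz₁ : y ≠ z := by rintro rfl; exact hyz' hzz'
      have hyz₂ : y ≠ z' := by rintro rfl; exact hyz hzz'.symm
      have hyw : H.Adj y w := (hP z hwz).resolve_right hyz
      obtain ⟨t, hzt, hz't⟩ := hedge hz hzz'
      have hyt : ¬ H.Adj y t := fun hyt => by
        rcases hpaw t z z' y hzt.symm hzz' hz't.symm hyt hyz₁ hyz₂ with h | h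
        exacts [hyz h, hyz' h]
      have hyt' : y ≠ t := by rintro rfl; exact hyz hzt.symm
      -- The vertex `w` forms a triangle with `z` and one of `z'`, `t`. Since `y` sees `w`, it must
      -- see a second vertex of that triangle, but it sees none of `z`, `z'`, `t`.
      rcases hpaw z z' t w hzz' hz't hzt hwz (by rintro rfl; exact hyz' hyw)
        (by rintro rfl; exact hyt hyw) with h | h
      · rcases hpaw w z z' y hwz hzz' h hyw hyz₁ hyz₂ with h | h
        exacts [hyz h, hyz' h]
      · rcases hpaw w z t y hwz hzt h hyw hyz₁ hyt' with h | h
        exacts [hyz h, hyt h]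
  obtain ⟨p⟩ := hy.symm.trans hu
  exact hdom p hy (fun w' h => Or.inr h) v huv

end PawFree

/-! ### Counting classes of size one -/

section Counting

variable {V A : Type*} [DecidableEq A] {C : Finset V}

/-- Fibre by fibre: a one-element fibre is counted twice on the right, and any other has at least
two elements. -/
theorem two_mul_card_image_le (φ : V → A) :
    2 * (C.image φ).card ≤ C.card + (C.filter fun x => ∀ y ∈ C, φ y = φ x → y = x).card := by
  rw [Finset.card_eq_sum_card_image φ C, Finset.card_eq_sum_card_fiberwise (f := φ)
    (s := C.filter fun x => ∀ y ∈ C, φ y = φ x → y = x) (t := C.image φ)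
    (fun x hx => Finset.mem_coe.2 (Finset.mem_image_of_mem φ (Finset.filter_subset _ _ hx))),
    ← Finset.sum_add_distrib, mul_comm, ← smul_eq_mul]
  refine Finset.card_nsmul_le_sum _ _ _ fun a ha => ?_
  obtain ⟨x, hx, rfl⟩ := Finset.mem_image.1 ha
  by_cases hal : ∀ y ∈ C, φ y = φ x → y = x
  · refine Nat.add_le_add (a := 1) (c := 1) (Finset.card_pos.2 ⟨x, by simp [hx]⟩)
      (Finset.card_pos.2 ⟨x, by simpa [hx] using hal⟩)
  · push Not at hal
    obtain ⟨y, hy, hyx, hne⟩ := hal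
    refine le_add_right ?_
    rw [← Finset.card_pair hne]
    refine Finset.card_le_card fun z hz => ?_
    rcases Finset.mem_insert.1 hz with rfl | hz
    · simp [hy, hyx]
    · rw [Finset.mem_singleton.1 hz]; simp [hx]

/-- Here fibres have at most two elements, and one-element fibres are counted twice on the left. -/
theorem le_two_mul_card_image {φ : V → A}
    (hφ : ∀ x ∈ C, ∀ y ∈ C, ∀ z ∈ C, φ x = φ y → φ y = φ z → x = y ∨ y = z ∨ x = z) :
    C.card + (C.filter fun x => ∀ y ∈ C, φ y = φ x → y = x).card ≤ 2 * (C.image φ).card := by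
  rw [Finset.card_eq_sum_card_image φ C, Finset.card_eq_sum_card_fiberwise (f := φ)
    (s := C.filter fun x => ∀ y ∈ C, φ y = φ x → y = x) (t := C.image φ)
    (fun x hx => Finset.mem_coe.2 (Finset.mem_image_of_mem φ (Finset.filter_subset _ _ hx))),
    ← Finset.sum_add_distrib, mul_comm, ← smul_eq_mul]
  refine Finset.sum_le_card_nsmul _ _ _ fun a ha => ?_
  rcases Finset.eq_empty_or_nonempty
    ((C.filter fun x => ∀ y ∈ C, φ y = φ x → y = x).filter fun x => φ x = a) with he | ⟨b, hb⟩
  · rw [he, Finset.card_empty, add_zero]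
    by_contra! h
    obtain ⟨x, y, z, hx, hy, hz, hxy, hxz, hyz⟩ := Finset.two_lt_card_iff.1 h
    simp only [Finset.mem_filter] at hx hy hz
    rcases hφ x hx.1 y hy.1 z hz.1 (hx.2.trans hy.2.symm) (hy.2.trans hz.2.symm) with h | h | h
    exacts [hxy h, hyz h, hxz h]
  · simp only [Finset.mem_filter] at hb
    have h1 : ∀ x ∈ C.filter fun x => φ x = a, x ∈ ({b} : Finset V) := fun x hx => by
      simp only [Finset.mem_filter] at hx
      exact Finset.mem_singleton.2 (hb.1.2 x hx.1 (hx.2.trans hb.2.symm))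
    refine Nat.add_le_add (b := 1) (d := 1)
      ((Finset.card_le_card h1).trans (Finset.card_singleton b).le)
      ((Finset.card_le_card fun x hx => h1 x ?_).trans (Finset.card_singleton b).le)
    simp only [Finset.mem_filter] at hx ⊢
    exact ⟨hx.1.1, hx.2⟩

/-- If `φ` has more classes than `ψ`, all of whose classes have size at most two, then some class
of size one of `φ` meets a class of size two of `ψ`. -/
theorem exists_alone_of_card_image_lt {B : Type*} [DecidableEq B] {φ : V → A} {ψ : V → B}
    (hψ : ∀ x ∈ C, ∀ y ∈ C, ∀ z ∈ C, ψ x = ψ y → ψ y = ψ z → x = y ∨ y = z ∨ x = z)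
    (h : (C.image ψ).card < (C.image φ).card) :
    ∃ v ∈ C, (∀ y ∈ C, φ y = φ v → y = v) ∧ ∃ u ∈ C, ψ u = ψ v ∧ u ≠ v := by
  by_contra! hcon
  have h1 := two_mul_card_image_le (C := C) φ
  have h2 := le_two_mul_card_image hψ
  have h3 : (C.filter fun x => ∀ y ∈ C, φ y = φ x → y = x).card ≤
      (C.filter fun x => ∀ y ∈ C, ψ y = ψ x → y = x).card := by
    refine Finset.card_le_card fun x hx => ?_
    simp only [Finset.mem_filter] at hx ⊢
    exact ⟨hx.1, hcon x hx.1 hx.2⟩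
  omega

end Counting

/-! ### The pieces of a `(P₃ + P₁)`-free graph and the choice of representatives -/

section Pieces

/-- The piece `c ⁻¹' {i}` has no three pairwise non-adjacent vertices. -/
def IsTripleFree {V κ : Type*} (G : SimpleGraph V) (c : V → κ) (i : κ) : Prop :=
  ∀ x y z, c x = i → c y = i → c z = i → x ≠ y → y ≠ z → x ≠ z →
    G.Adj x y ∨ G.Adj y z ∨ G.Adj x z

/-- The piece `c ⁻¹' {i}` is a disjoint union of cliques. -/
def IsCluster {V κ : Type*} (G : SimpleGraph V) (c : V → κ) (i : κ) : Prop :=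
  ∀ x y z, c x = i → c y = i → c z = i → x ≠ z → G.Adj x y → G.Adj y z → G.Adj x z

/-- A `(P₃ + P₁)`-free graph is the join of pieces without independent triples and of disjoint
unions of cliques. -/
theorem IsInducedFree.isTripleFree_or_isCluster {V : Type*} {G : SimpleGraph V}
    (h : IsInducedFree graphP3P1 G) (i : Gᶜ.ConnectedComponent) :
    IsTripleFree G Gᶜ.connectedComponentMk i ∨ IsCluster G Gᶜ.connectedComponentMk i := by
  by_contra! hn
  obtain ⟨hT, hC⟩ := hn
  simp only [IsTripleFree, IsCluster, not_forall] at hT hC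
  push Not at hT
  obtain ⟨x₀, a, b, hx₀, ha, hb, hxa, hab, hxb, nxa, nab, nxb⟩ := hT
  obtain ⟨x, y, z, hx, hy, hz, hxz, hxy, hyz, nxz⟩ := hC
  have hpaw : ∀ p q s w, Gᶜ.Adj p q → Gᶜ.Adj q s → Gᶜ.Adj p s → Gᶜ.Adj w p → w ≠ q → w ≠ s →
      Gᶜ.Adj w q ∨ Gᶜ.Adj w s := by
    intro p q s w hpq hqs hps hwp hwq hws
    simp only [SimpleGraph.compl_adj] at *
    by_contra! hn
    have h1 : G.Adj q w := by
      have := hn.1 hwq; exact this.symm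
    have h2 : G.Adj w s := hn.2 hws
    exact h.false_of_path_and_vertex h1 h2 hqs.2 hqs.1 hpq.2 (fun h => hwp.2 h.symm) hps.2
      hpq.1 hwp.1.symm hps.1
  have := adj_or_adj_of_paw_free hpaw (x₀ := x₀) (a₀ := a) (b₀ := b) (y := y) (u := x) (v := z)
    ⟨hxa, nxa⟩ ⟨hab, nab⟩ ⟨hxb, nxb⟩
    (SimpleGraph.ConnectedComponent.exact (hx₀.trans hy.symm))
    (SimpleGraph.ConnectedComponent.exact (hx₀.trans hx.symm)) ⟨hxz, nxz⟩
  rcases this with h | h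
  · exact h.2 hxy.symm
  · exact h.2 hyz

variable {V κ : Type*} [Fintype V] {G : SimpleGraph V} {k ℓ : ℕ} {c : V → κ}

/-- In an optimal colouring the colours of a disjoint union of cliques all appear on a single
clique. -/
theorem exists_clique_transversal (hc : ∀ u v, c u ≠ c v → G.Adj u v) {i : κ}
    (hi : IsCluster G c i) (g : G.Coloring (Fin k)) (hk : ∀ m, G.Colorable m → k ≤ m) :
    ∃ Q : Finset V, (∀ q ∈ Q, c q = i) ∧ G.IsClique Q ∧ ∀ v, c v = i → ∃ q ∈ Q, g q = g v := by
  by_cases hne : ∃ x, c x = i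
  swap
  · push Not at hne
    exact ⟨∅, by simp, by simp, fun v hv => absurd hv (hne v)⟩
  obtain ⟨x₀, hx₀⟩ := hne
  let D : V → Finset V := fun x => Finset.univ.filter fun y => c y = i ∧ (y = x ∨ G.Adj x y)
  have hD : ∀ x y, y ∈ D x ↔ c y = i ∧ (y = x ∨ G.Adj x y) := fun x y => by simp [D]
  -- The largest clique of the piece works. If a colour of the piece were missing on it, all cliques
  -- of the piece could be recoloured with the colours of the largest one, which frees that colour
  -- and contradicts optimality.
  obtain ⟨x, hx, hmax⟩ := Finset.exists_max_image (Finset.univ.filter fun x => c x = i)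
    (fun x => (D x).card) ⟨x₀, by simpa using hx₀⟩
  simp only [Finset.mem_filter, Finset.mem_univ, true_and] at hx hmax
  have hQ : G.IsClique (D x) := by
    intro u hu v hv huv
    have hu' := (hD x u).1 hu
    have hv' := (hD x v).1 hv
    rcases hu'.2 with rfl | h1
    · exact hv'.2.resolve_left huv.symm
    rcases hv'.2 with rfl | h2
    · exact h1.symm
    exact hi u x v hu'.1 hx hv'.1 huv h1.symm h2
  refine ⟨D x, fun q hq => ((hD x q).1 hq).1, hQ, ?_⟩
  by_contra! hcon
  obtain ⟨v₀, hv₀, hcon⟩ := hcon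
  have hginj : Set.InjOn g (D x) := fun u hu v hv huv => by
    by_contra hne
    exact g.valid (hQ hu hv hne) huv
  have : Nonempty (Fin k) := ⟨g x₀⟩
  have hemb : ∀ S : Finset V, S.card ≤ (D x).card →
      ∃ e : V → Fin k, Set.InjOn e S ∧ ∀ d ∈ S, e d ∈ (D x).image g := by
    intro S hS
    obtain ⟨e, he, heS⟩ := S.finite_toSet.exists_injOn_of_encard_le
      (t := (((D x).image g : Finset (Fin k)) : Set (Fin k))) (by
        rw [Set.encard_coe_eq_coe_finsetCard, Set.encard_coe_eq_coe_finsetCard,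
          Finset.card_image_of_injOn hginj]
        exact_mod_cast hS)
    exact ⟨e, heS, fun d hd => by simpa using he hd⟩
  choose! e he₁ he₂ using hemb
  have hDeq : ∀ u v, c u = i → c v = i → G.Adj u v → D u = D v := by
    have key : ∀ u v, c u = i → c v = i → G.Adj u v → D u ⊆ D v := by
      intro u v hu hv huv y hy
      obtain ⟨hyi, hy⟩ := (hD u y).1 hy
      refine (hD v y).2 ⟨hyi, ?_⟩
      rcases hy with rfl | hy
      · exact Or.inr huv.symm
      · by_cases hyv : y = v
        · exact Or.inl hyv
        · exact Or.inr (hi v u y hv hu hyi (Ne.symm hyv) huv.symm hy)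
    exact fun u v hu hv huv => (key u v hu hv huv).antisymm (key v u hv hu huv.symm)
  have hself : ∀ u, c u = i → u ∈ D u := fun u hu => (hD u u).2 ⟨hu, Or.inl rfl⟩
  let h : V → Fin k := fun v => if c v = i then e (D v) v else g v
  have hin : ∀ v, c v = i → h v ∈ (D x).image g := fun v hv => by
    simpa only [h, hv, if_true] using he₂ (D v) (hmax v hv) v (hself v hv)
  have hout : ∀ v, c v ≠ i → h v = g v := fun v hv => by simp [h, hv]
  have hcross : ∀ u v, c u = i → c v ≠ i → h u ≠ h v := by
    intro u v hu hv huv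
    obtain ⟨q, hq, hqu⟩ := Finset.mem_image.1 (hin u hu)
    rw [hout v hv, ← hqu] at huv
    exact g.valid (hc q v (by rw [((hD x q).1 hq).1]; exact hv.symm)) huv
  have hval : ∀ u v, G.Adj u v → h u ≠ h v := by
    intro u v huv
    by_cases hu : c u = i <;> by_cases hv : c v = i
    · simp only [h, hu, hv, if_true]
      rw [hDeq u v hu hv huv]
      refine fun heq => huv.ne (he₁ (D v) (hmax v hv) ?_ (hself v hv) heq)
      have := hself u hu
      rwa [hDeq u v hu hv huv] at this
    · exact hcross u v hu hv
    · exact (hcross v u hv hu).symm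
    · rw [hout u hu, hout v hv]; exact g.valid huv
  -- Outside the piece the colour of `v₀` does not occur, because all those vertices are adjacent to
  -- `v₀`.
  have hmiss : ∀ v, h v ≠ g v₀ := by
    intro v hvv
    by_cases hv : c v = i
    · obtain ⟨q, hq, hqv⟩ := Finset.mem_image.1 (hin v hv)
      exact hcon q hq (hqv.trans hvv)
    · rw [hout v hv] at hvv
      exact g.valid (hc v v₀ (by rw [hv₀]; exact hv)) hvv
  let h' : G.Coloring {j : Fin k // j ≠ g v₀} :=
    SimpleGraph.Coloring.mk (fun v => ⟨h v, hmiss v⟩) fun {u v} huv heq =>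
      hval u v huv (congrArg Subtype.val heq)
  have h1 := hk _ h'.colorable
  have h2 : Fintype.card {j : Fin k // j ≠ g v₀} < k := by
    have := Fintype.card_subtype_lt (p := fun j : Fin k => j ≠ g v₀) (x := g v₀) (by simp)
    simpa using this
  omega

/-- One can choose a representative of each class of an optimal colouring so that in each
disjoint union of cliques the representatives are pairwise adjacent. -/
theorem exists_representatives (hc : ∀ u v, c u ≠ c v → G.Adj u v)
    (hpieces : ∀ i, IsTripleFree G c i ∨ IsCluster G c i) (g : G.Coloring (Fin k))
    (hk : ∀ m, G.Colorable m → k ≤ m) :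
    ∃ r : V → V, (∀ v, g (r v) = g v) ∧ (∀ u v, g u = g v → r u = r v) ∧
      ∀ u v, c u = c v → ¬ IsTripleFree G c (c u) → r u ≠ r v → G.Adj (r u) (r v) := by
  have h1 : ∀ i, ∃ Q : Finset V, ¬ IsTripleFree G c i →
      (∀ q ∈ Q, c q = i) ∧ G.IsClique Q ∧ ∀ v, c v = i → ∃ q ∈ Q, g q = g v := by
    intro i
    by_cases hT : IsTripleFree G c i
    · exact ⟨∅, fun h => absurd hT h⟩
    · obtain ⟨Q, hQ⟩ := exists_clique_transversal hc ((hpieces i).resolve_left hT) g hk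
      exact ⟨Q, fun _ => hQ⟩
  choose Q hQ using h1
  have h2 : ∀ j : Set.range g, ∃ q, g q = j ∧ (¬ IsTripleFree G c (c q) → q ∈ Q (c q)) := by
    rintro ⟨_, v, rfl⟩
    by_cases hT : IsTripleFree G c (c v)
    · exact ⟨v, rfl, fun h => absurd hT h⟩
    · obtain ⟨q, hq, hqv⟩ := (hQ _ hT).2.2 v rfl
      refine ⟨q, hqv, fun _ => ?_⟩
      rwa [(hQ _ hT).1 q hq]
  choose R hR₁ hR₂ using h2
  have hcg : ∀ u v, g u = g v → c u = c v := by
    intro u v huv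
    by_contra hne
    exact g.valid (hc u v hne) huv
  refine ⟨fun v => R ⟨g v, v, rfl⟩, fun v => hR₁ _, fun u v huv => ?_, ?_⟩
  · have : (⟨g u, u, rfl⟩ : Set.range g) = ⟨g v, v, rfl⟩ := Subtype.ext huv
    simp only [this]
  · intro u v huv hT hne
    have hu := hcg _ _ (hR₁ ⟨g u, u, rfl⟩)
    have hv := hcg _ _ (hR₁ ⟨g v, v, rfl⟩)
    have hu' := hR₂ ⟨g u, u, rfl⟩ (by rwa [hu])
    have hv' := hR₂ ⟨g v, v, rfl⟩ (by rwa [hv, ← huv])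
    rw [hu] at hu'
    rw [hv, ← huv] at hv'
    exact (hQ _ hT).2.1 hu' hv' hne

end Pieces

/-! ### Aligning a colouring with an optimal one -/

section Alignment

variable {V κ : Type*} {G : SimpleGraph V} {k ℓ : ℕ} {c : V → κ}

theorem piece_eq_of_colour_eq (hc : ∀ u v, c u ≠ c v → G.Adj u v) {ι : Type*}
    (g : G.Coloring ι) {u v : V} (h : g u = g v) : c u = c v := by
  by_contra hne
  exact g.valid (hc u v hne) h

theorem eq_or_eq_of_isTripleFree (hc : ∀ u v, c u ≠ c v → G.Adj u v)
    (g : G.Coloring (Fin k)) {x y z : V} (hT : IsTripleFree G c (c x))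
    (hxy : g x = g y) (hyz : g y = g z) : x = y ∨ y = z ∨ x = z := by
  by_contra! hne
  have h1 := piece_eq_of_colour_eq hc g hxy
  have h2 := piece_eq_of_colour_eq hc g hyz
  rcases hT x y z rfl h1.symm (h2.symm.trans h1.symm) hne.1 hne.2.1 hne.2.2 with h | h | h
  exacts [g.valid h hxy, g.valid h hyz, g.valid h (hxy.trans hyz)]

theorem card_image_representatives {g : G.Coloring (Fin k)} {r : V → V}
    (hr₁ : ∀ v, g (r v) = g v) (C : Finset V) (hr₂ : ∀ u v, g u = g v → r u = r v) :
    (C.image r).card = (C.image g).card := by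
  have : (C.image g) = (C.image r).image g := by
    rw [Finset.image_image]
    exact Finset.image_congr fun v _ => (hr₁ v).symm
  rw [this]
  refine (Finset.card_image_of_injOn ?_).symm
  intro a ha b hb hab
  obtain ⟨u, -, rfl⟩ := Finset.mem_image.1 (Finset.mem_coe.1 ha)
  obtain ⟨v, -, rfl⟩ := Finset.mem_image.1 (Finset.mem_coe.1 hb)
  rw [hr₁, hr₁] at hab
  exact hr₂ u v hab

variable [Fintype V]

/-- The vertices whose colour differs from that of their representative. -/
noncomputable def misaligned (r : V → V) (α : G.Coloring (Fin ℓ)) : Finset V :=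
  Finset.univ.filter fun v => α v ≠ α (r v)

theorem mem_misaligned {r : V → V} {α : G.Coloring (Fin ℓ)} {v : V} :
    v ∈ misaligned r α ↔ α v ≠ α (r v) := by simp [misaligned]

/-- Twice the number of recolourings that may be spent on a misaligned vertex. -/
noncomputable def alignmentWeight (G : SimpleGraph V) (c : V → κ) (v : V) : ℕ :=
  if IsTripleFree G c (c v) then 4 else 3

/-- Some misaligned vertices can be aligned, within their budget, without misaligning others. -/
def CanAlign (c : V → κ) (r : V → V) (α : G.Coloring (Fin ℓ)) : Prop :=
  ∃ (β : G.Coloring (Fin ℓ)) (m : ℕ), (recolouringGraph G ℓ).edist α β ≤ m ∧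
    misaligned r β ⊂ misaligned r α ∧
    2 * m ≤ ∑ v ∈ misaligned r α \ misaligned r β, alignmentWeight G c v

theorem canAlign_of_class {g : G.Coloring (Fin k)} {r : V → V} (hr₁ : ∀ v, g (r v) = g v)
    {α β : G.Coloring (Fin ℓ)} {v : V} (hv : α v ≠ α (r v)) (hT : IsTripleFree G c (c v))
    (hβ₁ : ∀ w, g w = g v → β w = β v) (hβ₂ : ∀ w, g w ≠ g v → β w = α w)
    (hd : (recolouringGraph G ℓ).edist α β ≤ (2 : ℕ)) : CanAlign c r α := by
  have hgood : ∀ w, g w = g v → β w = β (r w) := fun w hw =>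
    (hβ₁ w hw).trans (hβ₁ (r w) ((hr₁ w).trans hw)).symm
  have hvβ : v ∉ misaligned r β := fun h => mem_misaligned.1 h (hgood v rfl)
  have hvα : v ∈ misaligned r α := mem_misaligned.2 hv
  refine ⟨β, 2, hd, (Finset.ssubset_iff_of_subset fun w hw => ?_).2 ⟨v, hvα, hvβ⟩, ?_⟩
  · rw [mem_misaligned] at hw ⊢
    have hwv : g w ≠ g v := fun h => hw (hgood w h)
    rwa [hβ₂ w hwv, hβ₂ (r w) (by rwa [hr₁])] at hw
  · have := Finset.single_le_sum (f := alignmentWeight G c) (fun _ _ => Nat.zero_le _)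
      (Finset.mem_sdiff.2 ⟨hvα, hvβ⟩)
    simpa [alignmentWeight, hT] using this

/-- The class of `v` consists of `v` and `r v` only, and both can take the unused colour: two
recolourings, exactly the budget of one misaligned vertex. -/
theorem canAlign_of_unused (hc : ∀ u v, c u ≠ c v → G.Adj u v) {g : G.Coloring (Fin k)}
    {r : V → V} (hr₁ : ∀ v, g (r v) = g v) {α : G.Coloring (Fin ℓ)} {v : V}
    (hv : α v ≠ α (r v)) (hT : IsTripleFree G c (c v)) {x : Fin ℓ} (hx : ∀ w, α w ≠ x) :
    CanAlign c r α := by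
  let β : G.Coloring (Fin ℓ) := SimpleGraph.Coloring.mk
    (fun w => if g w = g v then x else α w) (by
      intro a b hab
      by_cases ha : g a = g v <;> by_cases hb : g b = g v <;> simp only [ha, hb, if_true, if_false]
      · exact absurd (ha.trans hb.symm) (g.valid hab)
      · exact (hx b).symm
      · exact hx a
      · exact α.valid hab)
  have hβ : ∀ w, β w = if g w = g v then x else α w := fun _ => rfl
  have hdiff : ∀ w, α w ≠ β w → g w = g v := fun w hw => by
    by_contra h; simp [hβ, h] at hw
  refine canAlign_of_class (β := β) hr₁ hv hT (fun w hw => by simp [hβ, hw])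
    (fun w hw => by simp [hβ, hw]) ?_
  refine (edist_le_card_of_independent α β fun a b hab => ?_).trans (Nat.cast_le.2 ?_)
  · by_contra! h
    exact g.valid hab ((hdiff a h.1).trans (hdiff b h.2).symm)
  · refine (Finset.card_le_card (t := {v, r v}) fun w hw => ?_).trans Finset.card_le_two
    have hw' := hdiff w (by simpa using hw)
    have hne : v ≠ r v := fun h => hv (congrArg α h)
    have := eq_or_eq_of_isTripleFree hc g hT hw'.symm (hw'.trans (hr₁ v).symm)
    simp only [Finset.mem_insert, Finset.mem_singleton]
    tauto

/-- The colour of `v` occurs nowhere else, and `u` is not adjacent to `v`, so `u` can take it. This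
unifies the class `{u, v}` in one step. -/
theorem canAlign_of_alone (hc : ∀ u v, c u ≠ c v → G.Adj u v) {g : G.Coloring (Fin k)}
    {r : V → V} (hr₁ : ∀ v, g (r v) = g v) (hr₂ : ∀ u v, g u = g v → r u = r v)
    {α : G.Coloring (Fin ℓ)} {v u : V}
    (hv : ∀ w, α w = α v → w = v) (hT : IsTripleFree G c (c v)) (hu : u ≠ v) (hg : g u = g v) :
    CanAlign c r α := by
  obtain ⟨β, hβ, hβu, hβn⟩ := exists_recolour_vertex α (v := u) (x := α v) (by
    intro w huw hw
    rw [hv w hw] at huw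
    exact g.valid huw hg)
  have hβv : β v = α v := hβn v hu.symm
  have hαuv : α u ≠ α v := fun h => hu (hv u h)
  have hclass : ∀ w, g w = g v → w = u ∨ w = v := by
    intro w hw
    have := eq_or_eq_of_isTripleFree hc g hT hg.symm (hg.trans hw.symm)
    tauto
  obtain ⟨y, hgy, hy⟩ : ∃ y, g y = g v ∧ α y ≠ α (r y) := by
    rcases hclass (r v) (hr₁ v) with h | h
    · exact ⟨v, rfl, by rw [h]; exact hαuv.symm⟩
    · exact ⟨u, hg, by rwa [hr₂ u v hg, h]⟩
  have hone : ∀ w, g w = g v → β w = α v := by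
    intro w hw
    rcases hclass w hw with rfl | rfl
    exacts [hβu, hβv]
  refine canAlign_of_class (β := β) hr₁ hy
    (by rwa [piece_eq_of_colour_eq hc g hgy]) (fun w hw => ?_) (fun w hw => hβn w ?_)
    (hβ.trans (by norm_num))
  · rw [hone w (hw.trans hgy), hone y hgy]
  · rintro rfl
    exact hw (hg.trans hgy.symm)

/-- The whole clique `D` of `v` inside its piece takes the colours of its representatives. These lie
in another clique, hence have distinct colours, and do not move. The palette `P` of colours absent
from other pieces is larger than `D`, so `exists_rename` does it at 3/2 per changed vertex, and the
changed vertices are exactly the ones that become aligned. -/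
theorem canAlign_of_isCluster (hc : ∀ u v, c u ≠ c v → G.Adj u v) {g : G.Coloring (Fin k)}
    {r : V → V} (hr₁ : ∀ v, g (r v) = g v)
    (hr₃ : ∀ u v, c u = c v → ¬ IsTripleFree G c (c u) → r u ≠ r v → G.Adj (r u) (r v))
    {α : G.Coloring (Fin ℓ)} {v : V} (hv : α v ≠ α (r v)) (hT : ¬ IsTripleFree G c (c v))
    (hC : IsCluster G c (c v)) {P : Finset (Fin ℓ)}
    (hP : ∀ x, x ∈ P ↔ ∀ w, c w ≠ c v → α w ≠ x)
    (hcard : ((Finset.univ.filter fun w => c w = c v).image g).card < P.card) :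
    CanAlign c r α := by
  have hcr : ∀ w, c (r w) = c w := fun w => piece_eq_of_colour_eq hc g (hr₁ w)
  set D : Finset V := Finset.univ.filter fun y => c y = c v ∧ (y = v ∨ G.Adj v y) with hDdef
  have hD : ∀ y, y ∈ D ↔ c y = c v ∧ (y = v ∨ G.Adj v y) := fun y => by simp [hDdef]
  have hvD : v ∈ D := (hD v).2 ⟨rfl, Or.inl rfl⟩
  have hclique : ∀ a ∈ D, ∀ b ∈ D, a ≠ b → G.Adj a b := by
    intro a ha b hb hab
    obtain ⟨hac, ha⟩ := (hD a).1 ha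
    obtain ⟨hbc, hb⟩ := (hD b).1 hb
    rcases ha with rfl | ha
    · exact hb.resolve_left hab.symm
    rcases hb with rfl | hb
    · exact ha.symm
    exact hC a v b hac rfl hbc hab ha.symm hb
  have hclosed : ∀ a ∈ D, ∀ b, b ∉ D → G.Adj a b → c b ≠ c v := by
    intro a ha b hb hab hbc
    obtain ⟨hac, ha⟩ := (hD a).1 ha
    refine hb ((hD b).2 ⟨hbc, ?_⟩)
    rcases ha with rfl | ha
    · exact Or.inr hab
    by_cases hbv : b = v
    · exact Or.inl hbv
    · exact Or.inr (hC v a b rfl hac hbc (Ne.symm hbv) ha hab)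
  -- A misaligned `v` differs from `r v`, and two vertices of one class of `g` are not adjacent, so
  -- they lie in different cliques.
  have hrv : r v ∉ D := by
    intro h
    by_cases hne : v = r v
    · exact hv (congrArg α hne)
    · exact g.valid (hclique v hvD (r v) h hne) (hr₁ v).symm
  have hrD : ∀ u, r u ∉ D := by
    intro u hu
    have hcu : c u = c v := (hcr u).symm.trans ((hD _).1 hu).1
    by_cases hne : r u = r v
    · exact hrv (hne ▸ hu)
    · exact hclosed _ hu _ hrv (hr₃ u v hcu (by rwa [hcu]) hne) (hcr v)
  have hrinj : ∀ a ∈ D, ∀ b ∈ D, a ≠ b → α (r a) ≠ α (r b) := by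
    intro a ha b hb hab
    have hac := ((hD a).1 ha).1
    have hbc := ((hD b).1 hb).1
    refine α.valid (hr₃ a b (hac.trans hbc.symm) (by rwa [hac]) fun h => ?_)
    refine g.valid (hclique a ha b hb hab) ?_
    rw [← hr₁ a, h, hr₁]
  have hrP : ∀ a ∈ D, α (r a) ∈ P := fun a ha => (hP _).2 fun w hw =>
    α.valid (hc w (r a) (by rw [hcr, ((hD a).1 ha).1]; exact hw))
  let β : G.Coloring (Fin ℓ) := SimpleGraph.Coloring.mk
    (fun w => if w ∈ D then α (r w) else α w) (by
      intro a b hab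
      by_cases ha : a ∈ D <;> by_cases hb : b ∈ D <;> simp only [ha, hb, if_true, if_false]
      · exact hrinj a ha b hb hab.ne
      · exact ((hP _).1 (hrP a ha) b (hclosed a ha b hb hab)).symm
      · exact (hP _).1 (hrP b hb) a (hclosed b hb a ha hab.symm)
      · exact α.valid hab)
  have hβ : ∀ w, β w = if w ∈ D then α (r w) else α w := fun _ => rfl
  have hβD : ∀ w ∈ D, β w = α (r w) := fun w hw => by simp [hβ, hw]
  have hβn : ∀ w, w ∉ D → β w = α w := fun w hw => by simp [hβ, hw]
  have hDP : D.card < P.card := by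
    refine lt_of_le_of_lt ?_ hcard
    rw [← Finset.card_image_of_injOn (s := D) (f := g) fun a ha b hb hab => by
      by_contra hne; exact g.valid (hclique a ha b hb hne) hab]
    refine Finset.card_le_card (Finset.image_subset_image fun w hw => ?_)
    simpa using ((hD w).1 hw).1
  obtain ⟨m, hm, hm2⟩ := exists_rename G.selfColoring (D := D) (J := D) (P := P) (σ := α) (τ := β)
    (fun v hv => hv) hDP
    (fun a ha b hb hab => by
      by_contra hne; exact α.valid (hclique a ha b hb hne) hab)
    (fun a ha => (hP _).2 fun w hw => α.valid (hc w a (by rw [((hD a).1 ha).1]; exact hw)))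
    (fun a ha b hb hab => by
      by_contra hne; exact β.valid (hclique a ha b hb hne) hab)
    (fun a ha => by rw [hβD a ha]; exact hrP a ha) α β (fun _ _ => rfl) (fun _ _ => rfl) hβn
    (fun a ha b hb hab hbP => (hP _).1 hbP b (hclosed a ha b hb hab) rfl)
  have hmis : ∀ w, w ∈ misaligned r β ↔ w ∈ misaligned r α ∧ w ∉ D := by
    intro w
    rw [mem_misaligned, mem_misaligned, hβn _ (hrD w)]
    by_cases hw : w ∈ D
    · simp [hβD w hw, hw]
    · simp [hβn w hw, hw]
  refine ⟨β, m, hm, (Finset.ssubset_iff_of_subset fun w hw => ((hmis w).1 hw).1).2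
    ⟨v, mem_misaligned.2 hv, fun h => ((hmis v).1 h).2 hvD⟩, hm2.trans ?_⟩
  have hset : (Finset.univ.filter fun w => α w ≠ β w) = misaligned r α \ misaligned r β := by
    ext w
    simp only [Finset.mem_filter, Finset.mem_univ, true_and, Finset.mem_sdiff, hmis, not_and,
      not_not, mem_misaligned]
    by_cases hw : w ∈ D
    · simp [hβD w hw, hw]
    · simp [hβn w hw, hw]
  rw [hset, mul_comm, ← smul_eq_mul]
  refine Finset.card_nsmul_le_sum _ _ _ fun w _ => ?_
  unfold alignmentWeight
  split_ifs <;> omega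

/-- Distinct pieces are completely joined and share no colour of `g`, so the colours of `g` summed
over pieces number at most `k`, while those of `α` number at least `ℓ`. -/
theorem exists_piece_card_image_lt (hc : ∀ u v, c u ≠ c v → G.Adj u v) (g : G.Coloring (Fin k))
    (hkℓ : k < ℓ) {α : G.Coloring (Fin ℓ)} (hα : ∀ x, ∃ w, α w = x) :
    ∃ i, ((Finset.univ.filter fun w => c w = i).image g).card <
      ((Finset.univ.filter fun w => c w = i).image α).card := by
  by_contra! hcon
  have h1 : ℓ ≤ ∑ i ∈ Finset.univ.image c, ((Finset.univ.filter fun w => c w = i).image α).card := by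
    refine (Finset.card_fin ℓ).symm.le.trans (le_trans ?_ Finset.card_biUnion_le)
    refine Finset.card_le_card fun x _ => ?_
    obtain ⟨w, rfl⟩ := hα x
    simp only [Finset.mem_biUnion, Finset.mem_image, Finset.mem_filter, Finset.mem_univ, true_and]
    exact ⟨c w, ⟨w, rfl⟩, w, rfl, rfl⟩
  have h2 : ∑ i ∈ Finset.univ.image c, ((Finset.univ.filter fun w => c w = i).image g).card ≤ k := by
    rw [← Finset.card_biUnion]
    · exact (Finset.card_le_univ _).trans (Fintype.card_fin k).le
    · intro i _ j _ hij
      rw [Function.onFun, Finset.disjoint_left]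
      intro x hx hx'
      simp only [Finset.mem_image, Finset.mem_filter, Finset.mem_univ, true_and] at hx hx'
      obtain ⟨u, rfl, rfl⟩ := hx
      obtain ⟨w, rfl, hw⟩ := hx'
      exact hij (piece_eq_of_colour_eq hc g hw.symm)
  have h3 := Finset.sum_le_sum fun i (_ : i ∈ Finset.univ.image c) => hcon i
  omega

theorem canAlign (hc : ∀ u v, c u ≠ c v → G.Adj u v)
    (hpieces : ∀ i, IsTripleFree G c i ∨ IsCluster G c i) {g : G.Coloring (Fin k)} {r : V → V}
    (hr₁ : ∀ v, g (r v) = g v) (hr₂ : ∀ u v, g u = g v → r u = r v)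
    (hr₃ : ∀ u v, c u = c v → ¬ IsTripleFree G c (c u) → r u ≠ r v → G.Adj (r u) (r v))
    (hkℓ : k < ℓ) {α : G.Coloring (Fin ℓ)} (hne : (misaligned r α).Nonempty) :
    CanAlign c r α := by
  have hcr : ∀ w, c (r w) = c w := fun w => piece_eq_of_colour_eq hc g (hr₁ w)
  by_cases hα : ∀ x, ∃ w, α w = x
  · obtain ⟨i, hi⟩ := exists_piece_card_image_lt hc g hkℓ hα
    by_cases hT : IsTripleFree G c i
    · obtain ⟨v, hv, hal, u, hu, hg, hne⟩ := exists_alone_of_card_image_lt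
        (C := Finset.univ.filter fun w => c w = i) (fun x hx y _ z _ hxy hyz => eq_or_eq_of_isTripleFree hc g
          (by rwa [(Finset.mem_filter.1 hx).2]) hxy hyz) hi
      have hvi := (Finset.mem_filter.1 hv).2
      refine canAlign_of_alone hc hr₁ hr₂ (fun w hw => hal w ?_ hw) (by rwa [hvi]) hne hg
      simpa [hvi] using piece_eq_of_colour_eq hc α hw
    -- If the piece were fully aligned, the representatives would carry all its colours, and there
    -- are only as many of them as colours of `g`.
    · obtain ⟨v, hvi, hv⟩ : ∃ v, c v = i ∧ α v ≠ α (r v) := by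
        by_contra! hall
        refine hi.not_ge ?_
        rw [← card_image_representatives hr₁ _ hr₂]
        have : (Finset.univ.filter fun w => c w = i).image α
            = ((Finset.univ.filter fun w => c w = i).image r).image α := by
          rw [Finset.image_image]
          exact Finset.image_congr fun w hw => hall w (by simpa using hw)
        rw [this]
        exact Finset.card_image_le
      subst hvi
      refine canAlign_of_isCluster hc hr₁ hr₃ hv hT ((hpieces _).resolve_left hT)
        (P := Finset.univ.filter fun x => ∀ w, c w ≠ c v → α w ≠ x) (by simp)
        (hi.trans_le (Finset.card_le_card fun x hx => ?_))
      simp only [Finset.mem_image, Finset.mem_filter, Finset.mem_univ, true_and] at hx ⊢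
      obtain ⟨u, hu, rfl⟩ := hx
      exact fun w hw => α.valid (hc w u (by rwa [hu]))
  · push Not at hα
    obtain ⟨x, hx⟩ := hα
    obtain ⟨v, hv⟩ := hne
    rw [mem_misaligned] at hv
    by_cases hT : IsTripleFree G c (c v)
    · exact canAlign_of_unused hc hr₁ hv hT hx
    refine canAlign_of_isCluster hc hr₁ hr₃ hv hT ((hpieces _).resolve_left hT)
      (P := Finset.univ.filter fun x => ∀ w, c w ≠ c v → α w ≠ x) (by simp) ?_
    -- The palette contains the distinct colours of the representatives and also the unused colour
    -- `x`.
    rw [← card_image_representatives hr₁ _ hr₂,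
      ← Finset.card_image_of_injOn (f := α)
        (s := (Finset.univ.filter fun w => c w = c v).image r)]
    · refine Finset.card_lt_card ((Finset.ssubset_iff_of_subset fun y hy => ?_).2 ⟨x, ?_, ?_⟩)
      · simp only [Finset.mem_image, Finset.mem_filter, Finset.mem_univ, true_and] at hy ⊢
        obtain ⟨_, ⟨u, hu, rfl⟩, rfl⟩ := hy
        exact fun w hw => α.valid (hc w (r u) (by rwa [hcr, hu]))
      · simpa using fun w _ => hx w
      · intro h
        obtain ⟨w, -, hw⟩ := Finset.mem_image.1 h
        exact hx w hw
    · intro a ha b hb hab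
      obtain ⟨u, hu, rfl⟩ := Finset.mem_image.1 (Finset.mem_coe.1 ha)
      obtain ⟨w, hw, rfl⟩ := Finset.mem_image.1 (Finset.mem_coe.1 hb)
      have hu := (Finset.mem_filter.1 hu).2
      have hw := (Finset.mem_filter.1 hw).2
      by_contra hne
      exact α.valid (hr₃ u w (hu.trans hw.symm) (by rwa [hu]) hne) hab

theorem exists_aligned {r : V → V} (h : ∀ α : G.Coloring (Fin ℓ), (misaligned r α).Nonempty →
    CanAlign c r α) (n : ℕ) (α : G.Coloring (Fin ℓ)) (hn : (misaligned r α).card ≤ n) :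
    ∃ (β : G.Coloring (Fin ℓ)) (m : ℕ), (recolouringGraph G ℓ).edist α β ≤ m ∧
      misaligned r β = ∅ ∧ 2 * m ≤ ∑ v ∈ misaligned r α, alignmentWeight G c v := by
  induction n generalizing α with
  | zero => exact ⟨α, 0, by simp, by simpa using hn, by simp⟩
  | succ n ih =>
    rcases (misaligned r α).eq_empty_or_nonempty with he | hne
    · exact ⟨α, 0, by simp, he, by simp⟩
    obtain ⟨γ, m, hm, hss, hm2⟩ := h α hne
    have := Finset.card_lt_card hss
    obtain ⟨β, m', hm', hβ, hm2'⟩ := ih γ (by omega)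
    refine ⟨β, m + m', edist_le_add hm hm', hβ, ?_⟩
    have := Finset.sum_sdiff (f := alignmentWeight G c) hss.subset
    omega

/-- A misaligned vertex of weight 4 shares its class only with its representative, which is aligned.
The excess over weight 3 is thus charged injectively to aligned vertices. -/
theorem sum_alignmentWeight_le (hc : ∀ u v, c u ≠ c v → G.Adj u v) {g : G.Coloring (Fin k)}
    {r : V → V} (hr₁ : ∀ v, g (r v) = g v) (hr₂ : ∀ u v, g u = g v → r u = r v)
    (α : G.Coloring (Fin ℓ)) :
    ∑ v ∈ misaligned r α, alignmentWeight G c v ≤ 3 * Fintype.card V := by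
  have hcr : ∀ w, c (r w) = c w := fun w => piece_eq_of_colour_eq hc g (hr₁ w)
  have hrr : ∀ v, r (r v) = r v := fun v => hr₂ _ _ (hr₁ v)
  set B := (misaligned r α).filter fun v => IsTripleFree G c (c v) with hB
  set B' := (misaligned r α).filter fun v => ¬ IsTripleFree G c (c v)
  have hBr : B.card ≤ (misaligned r α)ᶜ.card := by
    refine Finset.card_le_card_of_injOn r (fun v _ => ?_) fun u hu v hv huv => ?_
    · simp [mem_misaligned, hrr]
    · have hu := Finset.mem_filter.1 (Finset.mem_coe.1 hu)
      have hv := Finset.mem_filter.1 (Finset.mem_coe.1 hv)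
      rw [mem_misaligned] at hu hv
      rcases eq_or_eq_of_isTripleFree hc g hu.2
        (show g u = g v by rw [← hr₁ u, huv, hr₁]) (hr₁ v).symm with h | h | h
      · exact h
      · exact absurd (congrArg α h) hv.1
      · exact absurd (congrArg α (h.trans huv.symm)) hu.1
  have h1 : B.card + B'.card = (misaligned r α).card := Finset.card_filter_add_card_filter_not _
  have h2 := Finset.card_add_card_compl (misaligned r α)
  have h3 : ∑ v ∈ misaligned r α, alignmentWeight G c v = 4 * B.card + 3 * B'.card := by
    unfold alignmentWeight
    rw [Finset.sum_ite, Finset.sum_const, Finset.sum_const, smul_eq_mul, smul_eq_mul]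
    ring
  omega

theorem edist_le_of_path_and_vertex_free (h : IsInducedFree graphP3P1 G) (hcol : G.Colorable k)
    (hk : ∀ m, G.Colorable m → k ≤ m) (hkℓ : k < ℓ) (α β : G.Coloring (Fin ℓ)) :
    (recolouringGraph G ℓ).edist α β ≤ (9 * Fintype.card V / 2 : ℕ) := by
  obtain ⟨g⟩ := hcol
  have hc : ∀ u v, Gᶜ.connectedComponentMk u ≠ Gᶜ.connectedComponentMk v → G.Adj u v := by
    intro u v huv
    by_contra hadj
    have hne : u ≠ v := by rintro rfl; exact huv rfl
    exact huv (SimpleGraph.ConnectedComponent.sound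
      (SimpleGraph.Adj.reachable ((SimpleGraph.compl_adj _ _ _).2 ⟨hne, hadj⟩)))
  obtain ⟨r, hr₁, hr₂, hr₃⟩ := exists_representatives hc h.isTripleFree_or_isCluster g hk
  have hsurj : Function.Surjective g := by
    intro x
    by_contra! hx
    let h' : G.Coloring {j : Fin k // j ≠ x} :=
      SimpleGraph.Coloring.mk (fun v => ⟨g v, hx v⟩) fun {u v} huv heq =>
        g.valid huv (congrArg Subtype.val heq)
    have h1 := hk _ h'.colorable
    have h2 := Fintype.card_subtype_lt (p := fun j : Fin k => j ≠ x) (x := x) (by simp)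
    rw [Fintype.card_fin] at h2
    omega
  choose s hs using hsurj
  refine (edist_le_of_aligned g (by simpa using hkℓ) (N := 3 * Fintype.card V / 2)
    (fun α => ?_) α β).trans (Nat.cast_le.2 (by omega))
  obtain ⟨γ, m, hm, hγ, hm2⟩ := exists_aligned (c := Gᶜ.connectedComponentMk) (r := r)
    (fun α hne => canAlign hc h.isTripleFree_or_isCluster hr₁ hr₂ hr₃ hkℓ hne) _ α le_rfl
  have hsum := sum_alignmentWeight_le hc hr₁ hr₂ α
  have hγr : ∀ v, γ v = γ (r v) := fun v => by
    by_contra hv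
    have : v ∈ misaligned r γ := mem_misaligned.2 hv
    simp [hγ] at this
  have hγs : ∀ v, γ v = γ (s (g v)) := fun v => by
    rw [hγr v, hγr (s (g v)), hr₂ _ _ (hs (g v))]
  refine ⟨γ, fun j => γ (s j), ?_, hγs, hm.trans (Nat.cast_le.2 (by omega))⟩
  intro i j hij
  by_contra hne
  -- If two classes of `g` had the same colour under `γ`, merging them would give a proper colouring
  -- with fewer colours.
  let h' : G.Coloring {a : Fin k // a ≠ i} := SimpleGraph.Coloring.mk
    (fun v => if hv : g v = i then ⟨j, Ne.symm hne⟩ else ⟨g v, hv⟩) (by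
      intro u v huv heq
      refine γ.valid huv ?_
      rw [hγs u, hγs v]
      by_cases hu : g u = i <;> by_cases hv : g v = i <;> simp [hu, hv] at heq
      · rw [hu, hv]
      · rw [hu, ← heq]; exact hij
      · rw [hv, heq]; exact hij.symm
      · rw [heq])
  have h1 := hk _ h'.colorable
  have h2 := Fintype.card_subtype_lt (p := fun a : Fin k => a ≠ i) (x := i) (by simp)
  rw [Fintype.card_fin] at h2
  omega

end Alignment

/-! ### From the chromatic number to the theorem -/

theorem exists_colorable_of_chromaticNumber_add_one_le {V : Type*} {G : SimpleGraph V} {ℓ : ℕ}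
    (h : G.chromaticNumber + 1 ≤ (ℓ : ℕ∞)) :
    ∃ k, G.Colorable k ∧ (∀ m, G.Colorable m → k ≤ m) ∧ k < ℓ := by
  have hne : G.chromaticNumber ≠ ⊤ := fun ht => by simp [ht] at h
  obtain ⟨k, hk⟩ := ENat.ne_top_iff_exists.1 hne
  rw [← hk] at h
  refine ⟨k, SimpleGraph.chromaticNumber_le_iff_colorable.1 hk.symm.le, fun m hm => ?_, ?_⟩
  · have := hm.chromaticNumber_le
    rw [← hk] at this
    exact_mod_cast this
  · have : k + 1 ≤ ℓ := by exact_mod_cast h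
    omega

/-- Natural-number division gives the floors `⌊9n/2⌋` and `⌊7n/2⌋`. The diameter is the extended
one, with value `⊤` on a disconnected graph. -/
theorem mainTheorem4 :
    (∀ (V : Type*) [Fintype V] (G : SimpleGraph V) (ℓ : ℕ),
      IsInducedFree graphP3P1 G → G.chromaticNumber + 1 ≤ (ℓ : ℕ∞) →
        (recolouringGraph G ℓ).Connected ∧
        (recolouringGraph G ℓ).ediam ≤ ((9 * Fintype.card V / 2 : ℕ) : ℕ∞)) ∧
    (∀ (V : Type*) [Fintype V] (G : SimpleGraph V) (ℓ : ℕ),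
      IsInducedFree graph2K2 G → IsInducedFree (SimpleGraph.cycleGraph 4) G →
        G.chromaticNumber + 1 ≤ (ℓ : ℕ∞) →
        (recolouringGraph G ℓ).Connected ∧
        (recolouringGraph G ℓ).ediam ≤ ((7 * Fintype.card V / 2 : ℕ) : ℕ∞)) := by
  refine ⟨fun V _ G ℓ h hℓ => ?_, fun V _ G ℓ h2 h4 hℓ => ?_⟩ <;>
    obtain ⟨k, hcol, hk, hkℓ⟩ := exists_colorable_of_chromaticNumber_add_one_le hℓ
  · exact connected_and_ediam_le (hcol.mono hkℓ.le)
      (edist_le_of_path_and_vertex_free h hcol hk hkℓ)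
  · exact connected_and_ediam_le (hcol.mono hkℓ.le)
      (edist_le_of_two_edge_free_of_four_cycle_free h2 h4 hcol hkℓ)
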